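/- **Conventions.** C*-algebras may be non-unital. For a C*-algebra $A$, $sa(A)$ is its self-adjoint part and $\mathscr S(A)$ its state space (positive functionals of norm one) with the weak* topology. A *Lipschitz pair* $(A,L)$ is a C*-algebra $A$ with a seminorm $L$ on a dense subspace of the self-adjoint part of the smallest unitization of $A$, with $\{L=0\}=\mathbb R1$; put $L=\infty$ off the domain. It is *Leibniz* if $L(\frac{ab+ba}2)$ and $L(\frac{ab-ba}{2i})$ are at most $\|a\|L(b)+L(a)\|b\|$ for all $a,b\in sa(A)$. Let $\mathrm{mk}_L(\varphi,\psi)=\sup\{|\varphi(a)-\psi(a)|:a\in sa(A),L(a)\le1\}$. For subsets of an extended metric space, $X\subseteq_\varepsilon Y$ means that every point of $X$ is at distance at most $\varepsilon$ from some point of $Y$. **Compact spaces.** A *Leibniz quantum compact metric space* is a Leibniz Lipschitz pair $(A,L)$ with $A\neq0$ unital, $L$ norm lower semicontinuous, and $\mathrm{mk}_L$ metrizing the weak* topology of $\mathscr S(A)$. A *tunnel* from $(A,L_A)$ to $(B,L_B)$ is a Leibniz quantum compact metric space $(D,L_D)$ with unital *-epimorphisms $\pi:D\to A$, $\rho:D\to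 B$ such that $L_A(a)=\inf\{L_D(d):d\in sa(D),\pi(d)=a\}$ for all $a\in sa(A)$, and likewise for $\rho$, $L_B$. Its *extent* is the maximum of the $\mathrm{mk}_{L_D}$-Hausdorff distances from $\mathscr S(D)$ to $\pi^*\mathscr S(A)=\{\varphi\circ\pi:\varphi\in\mathscr S(A)\}$ and to $\rho^*\mathscr S(B)$. The *dual Gromov–Hausdorff propinquity* $\Lambda^*((A,L_A),(B,L_B))$ is the infimum of the extents of all tunnels from $(A,L_A)$ to $(B,L_B)$. **Pointed proper spaces.** A *topography* of $A$ is an Abelian C*-subalgebra $M\subseteq A$ containing an approximate unit of $A$; $M^\sigma$ is its Gel'fand spectrum. For $K\subseteq M^\sigma$ compact let $\chi_K\in M^{**}\subseteq A^{**}$ be its indicator projection, $\mathscr S[A|K]=\{\varphi\in\mathscr S(A):\varphi(\chi_K)=1\}$, $\mathrm{Loc}[A|K]=\{a\in sa(A):a=\chi_Ka\chi_K,\ L(a)<\infty\}$, and let $\mathrm{Loc}[A|\star]$ be the union of the $\mathrm{Loc}[A|K]$ over compact $K$. A set $S\subseteq\mathscr S(A)$ is *tame* if $\sup\{|\varphi(a-\chi_Ka\chi_K)|:\varphi\in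 S,\,a\in sa(A),\,L(a)\le1\}\to0$ along the compact sets $K\subseteq M^\sigma$ directed by inclusion. $(A,L,M)$ is a *quantum locally compact metric space* if $(A,L)$ is a Lipschitz pair, $M$ is a topography, and $\mathrm{mk}_L$ metrizes the weak* topology of every tame set. It is *proper* if moreover $A$ is separable, $(A,L)$ is Leibniz, $L$ is norm lower semicontinuous on $sa(A)$, $\mathrm{Loc}[A|\star]$ is dense in $\{a\in sa(A):L(a)<\infty\}$, $\mathrm{Loc}[A|\star]\cap M$ is dense in $sa(M)$, and $M^\sigma$ with the metric $\mathrm{mk}^\sigma_L(x,y)=\sup\{|x(m)-y(m)|:m\in sa(M),L(m)\le1\}$ is a proper metric space. A *pointed proper quantum metric space* $\mathbb A=(A,L,M,\mu)$ carries moreover a base point $\mu\in M^\sigma$; write $\mathrm{Loc}[A|\mu,r]$ and $\mathscr S[A|\mu,r]$ for $\mathrm{Loc}[A|K]$ and $\mathscr S[A|K]$ with $K$ the closed $\mathrm{mk}^\sigma_L$-ball of centre $\mu$ and radius $r$. The pointed proper quantum metric space *canonically associated* with a Leibniz quantum compact metric space $(A,L)$ is $(A,L,\mathbb C1_A,\ t1_A\mapsto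 t)$. **Passages and the hypertopology.** A *passage* from $\mathbb A=(A,L_A,M_A,\mu_A)$ to $\mathbb B=(B,L_B,M_B,\mu_B)$ is a quantum locally compact metric space $(D,L_D,M_D)$, $L_D$ norm lower semicontinuous, with *-epimorphisms $\pi:D\to A$, $\rho:D\to B$ such that $\pi(M_D)\subseteq M_A$, $\rho(M_D)\subseteq M_B$ and each maps some approximate unit of $D$ in $M_D$ to an approximate unit. For $r,\varepsilon>0$ and $K\subseteq M_D^\sigma$ compact, $(\varepsilon,K)$ is *$r$-left admissible* if 1. $\pi^*\mathscr S[A|\mu_A,r]\subseteq\mathscr S[D|K]\subseteq_\varepsilon\pi^*\mathscr S[A|\mu_A,r+4\varepsilon]$ for $\mathrm{mk}_{L_D}$; 2. every $a\in\mathrm{Loc}[A|\mu_A,r]$ has a lift $d\in\mathrm{Loc}[D|K]$ with $\pi(d)=a$, $L_D(d)\le L_A(a)$, $\rho(d)\in\mathrm{Loc}[B|\mu_B,r+4\varepsilon]$; and if $a\in M_A$, then such a lift exists with moreover $\rho(d)\in M_B$; 3. $L_B(\rho(d))\le L_D(d)$ for all $d\in\mathrm{Loc}[D|K]$. It is *$r$-admissible*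 if it is $r$-left admissible, both for the passage and for the passage with the roles of $(\pi,\mathbb A)$ and $(\rho,\mathbb B)$ exchanged, if $\mathrm{mk}^\sigma_{L_D}(\mu_A\circ\pi,\mu_B\circ\rho)\le\varepsilon$, and if the two Leibniz inequalities hold for $L_D$ on $\mathrm{Loc}[D|K]$. A number $\varepsilon>0$ is *$r$-admissible* if there are compact sets $(K_t)_{0<t\le r}$, increasing in $t$, such that $(\varepsilon,K_t)$ is $t$-admissible for every $t\in(0,r]$. A passage is an *$r$-tunnel* if it has an $r$-admissible number, and its *$r$-extent* is the infimum of these numbers. Let $\Lambda_r(\mathbb A,\mathbb B)$ be the infimum of the $r$-extents of all $r$-tunnels from $\mathbb A$ to $\mathbb B$ ($\infty$ if there are none), and let $$\Lambda(\mathbb A,\mathbb B)=\min\Big\{\inf\{\varepsilon>0:\Lambda_{1/\varepsilon}(\mathbb A,\mathbb B)<\varepsilon\},\ \tfrac{\sqrt2}4\Big\}.$$ The *topographic Gromov–Hausdorff hypertopology* is the topology on the class of pointed proper quantum metric spaces whose closed classes are those which contain every $\mathbb B$ such that $\Lambda(\mathbb A_n,\mathbb B)\to0$ for some sequence $(\mathbb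 A_n)$ in the class. **Theorem.** Let $(A_n,L_n)_{n\in\mathbb N}$ and $(A,L)$ be Leibniz quantum compact metric spaces, and let $\mathbb A_n$ and $\mathbb A$ be the canonically associated pointed proper quantum metric spaces. Then $(A_n,L_n)$ converges to $(A,L)$ for the dual Gromov–Hausdorff propinquity, that is, $\Lambda^*((A_n,L_n),(A,L))\to0$, if and only if $\mathbb A_n$ converges to $\mathbb A$ for the topographic Gromov–Hausdorff hypertopology. -/

import Mathlib

open Filter Topology
open scoped ENNReal ComplexOrder

universe u

noncomputable section

namespace QuantumMetric

/-! ### Lipschitz seminorms, states and the Monge-Kantorovich metric -/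

/-- `a` is a real multiple of the unit, `a ∈ ℝ1`, where `1` is the unit of the smallest
unitization of `A`: if `A` has no unit, then the only such element of `A` is `0`. -/
def IsRealScalar {A : Type u} [NonUnitalCStarAlgebra A] (a : A) : Prop :=
  a = 0 ∨ ∃ (e : A) (t : ℝ), (∀ b, e * b = b ∧ b * e = b) ∧ a = (t : ℂ) • e

/-- The seminorm `L` of a Lipschitz pair `(A, L)`, extended by `∞` outside of its domain. The domain
`{a | L a < ∞}` is a dense real subspace of the self-adjoint part `sa(A)` and
`{a | L a = 0} = ℝ1 ∩ A`.

A seminorm on a dense subspace of `sa(uA)` (`uA` the smallest unitization of `A`) which vanishes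
exactly on `ℝ1` satisfies `L (a + t1) = L a`, so it is the same thing as its restriction to
`sa(A)`, whose domain is dense in `sa(A)`. It is this restriction which is recorded here. -/
structure LipSeminorm (A : Type u) [NonUnitalCStarAlgebra A] where
  toFun : A → ℝ≥0∞
  eq_top : ∀ a, ¬ IsSelfAdjoint a → toFun a = ∞
  add_le : ∀ a b, toFun (a + b) ≤ toFun a + toFun b
  smul_eq : ∀ (t : ℝ) (a : A), toFun ((t : ℂ) • a) = ‖t‖ₑ * toFun a
  dense_dom : ∀ a, IsSelfAdjoint a → a ∈ closure {b | toFun b < ∞}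
  eq_zero_iff : ∀ a, toFun a = 0 ↔ IsRealScalar a

instance {A : Type u} [NonUnitalCStarAlgebra A] : CoeFun (LipSeminorm A) (fun _ => A → ℝ≥0∞) :=
  ⟨LipSeminorm.toFun⟩

/-- The state space `𝒮(A)`: positive linear functionals of norm one. -/
def State (A : Type u) [NonUnitalCStarAlgebra A] : Type u :=
  {φ : WeakDual ℂ A // (∀ a : A, 0 ≤ φ (star a * a)) ∧ ‖WeakDual.toStrongDual φ‖ = 1}

/-- The weak* topology on the state space. -/
instance (A : Type u) [NonUnitalCStarAlgebra A] : TopologicalSpace (State A) :=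
  instTopologicalSpaceSubtype

instance (A : Type u) [NonUnitalCStarAlgebra A] : CoeFun (State A) (fun _ => A → ℂ) :=
  ⟨fun φ a => φ.1 a⟩

/-- `sup {|f a - g a| : a ∈ S}`. -/
def supDist {X : Type u} (S : Set X) (f g : X → ℂ) : ℝ≥0∞ :=
  ⨆ a ∈ S, edist (f a) (g a)

/-- The extended pseudo-metric obtained from `supDist` on a type of functions on `X`. -/
abbrev supMetric {X Y : Type u} (S : Set X) (ev : Y → X → ℂ) : PseudoEMetricSpace Y where
  edist x y := supDist S (ev x) (ev y)
  edist_self x := by simp [supDist]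
  edist_comm x y := by simp [supDist, edist_comm]
  edist_triangle x y z := by
    refine iSup₂_le fun a ha => (edist_triangle _ (ev y a) _).trans ?_
    exact add_le_add (le_iSup₂ (f := fun a (_ : a ∈ S) => edist (ev x a) (ev y a)) a ha)
      (le_iSup₂ (f := fun a (_ : a ∈ S) => edist (ev y a) (ev z a)) a ha)

/-- The Monge-Kantorovich metric of `L` on the state space. -/
abbrev mkMetric {A : Type u} [NonUnitalCStarAlgebra A] (L : LipSeminorm A) :
    PseudoEMetricSpace (State A) :=
  supMetric {a | L a ≤ 1} (fun φ a => φ a)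

/-- The topology of the Monge-Kantorovich metric on the state space. -/
abbrev mkTopology {A : Type u} [NonUnitalCStarAlgebra A] (L : LipSeminorm A) :
    TopologicalSpace (State A) :=
  (mkMetric L).toUniformSpace.toTopologicalSpace

/-- The Monge-Kantorovich metric metrizes the weak* topology of the set of states `S`. -/
def Metrizes {A : Type u} [NonUnitalCStarAlgebra A] (L : LipSeminorm A) (S : Set (State A)) :
    Prop :=
  TopologicalSpace.induced (Subtype.val : S → State A) (mkTopology L) =
    TopologicalSpace.induced (Subtype.val : S → State A) inferInstance

/-- The Leibniz inequalities for the Jordan product `(ab + ba)/2` and the Lie product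
`(ab - ba)/(2i)`, for the self-adjoint elements of `S`. -/
def LeibnizOn {A : Type u} [NonUnitalCStarAlgebra A] (L : LipSeminorm A) (S : Set A) : Prop :=
  ∀ a ∈ S, ∀ b ∈ S, IsSelfAdjoint a → IsSelfAdjoint b →
    L ((1 / 2 : ℂ) • (a * b + b * a)) ≤ ‖a‖ₑ * L b + L a * ‖b‖ₑ ∧
    L ((1 / (2 * Complex.I) : ℂ) • (a * b - b * a)) ≤ ‖a‖ₑ * L b + L a * ‖b‖ₑ

/-- Norm lower semicontinuity on the self-adjoint part. -/
def LowerSemi {A : Type u} [NonUnitalCStarAlgebra A] (L : LipSeminorm A) : Prop :=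
  LowerSemicontinuousOn L {a | IsSelfAdjoint a}

/-! ### Topographies and locality -/

/-- `M` is a topography of `A`: an Abelian C*-subalgebra containing an approximate unit of `A`. -/
structure IsTopography {A : Type u} [NonUnitalCStarAlgebra A] (M : NonUnitalStarSubalgebra ℂ A) :
    Prop where
  isClosed : IsClosed (M : Set A)
  comm : ∀ x ∈ M, ∀ y ∈ M, x * y = y * x
  approxUnit : ∃ l : Filter A, l.IsApproximateUnit ∧ (M : Set A) ∈ l

/-- The Gel'fand spectrum of `M`. -/
abbrev Spec {A : Type u} [NonUnitalCStarAlgebra A] (M : NonUnitalStarSubalgebra ℂ A) : Type u :=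
  WeakDual.characterSpace ℂ M

/-- The elements `m ∈ M` with `0 ≤ m ≤ 1` as functions on the spectrum of `M`, and `m = 1` on `K`.
For `K` compact they form a decreasing net (for the pointwise order) whose limit, in the strong
topology of the enveloping von Neumann algebra `A**`, is the indicator projection `χ_K` of `K`. -/
def unitsOn {A : Type u} [NonUnitalCStarAlgebra A] (M : NonUnitalStarSubalgebra ℂ A)
    (K : Set (Spec M)) : Set M :=
  {m | (∀ x : Spec M, 0 ≤ x m ∧ x m ≤ 1) ∧ ∀ x ∈ K, x m = 1}

/-- `z = φ (χ_K a χ_K)`: as states are normal on `A**`, this number is the limit of `φ (m a m)`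
along the decreasing net of all `m ∈ unitsOn M K`. -/
def IsCornerValue {A : Type u} [NonUnitalCStarAlgebra A] (M : NonUnitalStarSubalgebra ℂ A)
    (K : Set (Spec M)) (φ : State A) (a : A) (z : ℂ) : Prop :=
  ∀ ε : ℝ, 0 < ε → ∃ m₀ ∈ unitsOn M K, ∀ m ∈ unitsOn M K, (∀ x : Spec M, x m ≤ x m₀) →
    ‖φ ((m : A) * a * (m : A)) - z‖ < ε

/-- `a = χ_K a χ_K` in `A**`. Since `m χ_K = χ_K` for `m ∈ unitsOn M K`, and `χ_K` is the limit of
these `m`, this says that `a = m a m` for all such `m`. -/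
def SupportedOn {A : Type u} [NonUnitalCStarAlgebra A] (M : NonUnitalStarSubalgebra ℂ A)
    (K : Set (Spec M)) (a : A) : Prop :=
  ∀ m ∈ unitsOn M K, (m : A) * a * (m : A) = a

/-- `𝒮[A|K]`, the states with `φ (χ_K) = 1`. Since `φ (χ_K)` is the infimum of the numbers
`φ m ≤ 1`, `m ∈ unitsOn M K`, this says that all of these are `1`. -/
def localStates {A : Type u} [NonUnitalCStarAlgebra A] (M : NonUnitalStarSubalgebra ℂ A)
    (K : Set (Spec M)) : Set (State A) :=
  {φ | ∀ m ∈ unitsOn M K, φ (m : A) = 1}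

/-- `Loc[A|M, K]`: self-adjoint `a = χ_K a χ_K` with `L a < ∞`. -/
def Loc {A : Type u} [NonUnitalCStarAlgebra A] (L : LipSeminorm A)
    (M : NonUnitalStarSubalgebra ℂ A) (K : Set (Spec M)) : Set A :=
  {a | L a < ∞ ∧ SupportedOn M K a}

/-- `Loc[A|M, ⋆]`, the union of all `Loc[A|M, K]` with `K` compact. -/
def LocStar {A : Type u} [NonUnitalCStarAlgebra A] (L : LipSeminorm A)
    (M : NonUnitalStarSubalgebra ℂ A) : Set A :=
  {a | ∃ K : Set (Spec M), IsCompact K ∧ a ∈ Loc L M K}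

/-- Tame sets of states: the supremum of `|φ (a - χ_K a χ_K)|` over `φ ∈ S`, `L a ≤ 1`, tends to
`0` along the compact sets `K` ordered by inclusion. -/
def Tame {A : Type u} [NonUnitalCStarAlgebra A] (L : LipSeminorm A)
    (M : NonUnitalStarSubalgebra ℂ A) (S : Set (State A)) : Prop :=
  ∀ ε : ℝ, 0 < ε → ∃ K₀ : Set (Spec M), IsCompact K₀ ∧
    ∀ K : Set (Spec M), IsCompact K → K₀ ⊆ K → ∀ φ ∈ S, ∀ a : A, L a ≤ 1 →
      ∃ z : ℂ, IsCornerValue M K φ a z ∧ ‖φ a - z‖ ≤ ε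

/-- `(A, L, M)` is a quantum locally compact metric space. -/
structure IsLocallyCompactQMS {A : Type u} [NonUnitalCStarAlgebra A] (L : LipSeminorm A)
    (M : NonUnitalStarSubalgebra ℂ A) : Prop where
  topography : IsTopography M
  metrizes : ∀ S : Set (State A), Tame L M S → Metrizes L S

/-! ### Pointed proper quantum metric spaces -/

/-- The Monge-Kantorovich metric of the restriction of `L` to `M`, on the spectrum of `M`. -/
abbrev specMetric {A : Type u} [NonUnitalCStarAlgebra A] (L : LipSeminorm A)
    (M : NonUnitalStarSubalgebra ℂ A) : PseudoEMetricSpace (Spec M) :=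
  supMetric {m : M | L (m : A) ≤ 1} (fun x m => x m)

/-- The closed ball of centre `x` and radius `r` in the spectrum of `M`. -/
def specBall {A : Type u} [NonUnitalCStarAlgebra A] (L : LipSeminorm A)
    (M : NonUnitalStarSubalgebra ℂ A) (x : Spec M) (r : ℝ) : Set (Spec M) :=
  {y | (specMetric L M).edist y x ≤ ENNReal.ofReal r}

/-- An extended pseudo-metric is a proper metric: it is finite, separates points and its closed
balls are compact (for its own topology). -/
def IsProperMetric {X : Type u} (d : PseudoEMetricSpace X) : Prop :=
  (∀ x y, d.edist x y ≠ ∞) ∧ (∀ x y, d.edist x y = 0 → x = y) ∧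
    ∀ (x : X) (r : ℝ), 0 ≤ r →
      @IsCompact X d.toUniformSpace.toTopologicalSpace {y | d.edist y x ≤ ENNReal.ofReal r}

/-- `(A, L, M)` is a proper quantum metric space. -/
structure IsProperQMS {A : Type u} [NonUnitalCStarAlgebra A] (L : LipSeminorm A)
    (M : NonUnitalStarSubalgebra ℂ A) : Prop where
  locallyCompact : IsLocallyCompactQMS L M
  separable : TopologicalSpace.SeparableSpace A
  leibniz : LeibnizOn L Set.univ
  lowerSemi : LowerSemi L
  dense_loc : {a : A | L a < ∞} ⊆ closure (LocStar L M)
  dense_loc_topography :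
    {a : A | a ∈ M ∧ IsSelfAdjoint a} ⊆ closure (LocStar L M ∩ (M : Set A))
  proper : IsProperMetric (specMetric L M)

/-- Pointed proper quantum metric spaces `(A, L, M, μ)`, with base point `μ` in the spectrum of
the topography `M`. -/
structure PointedProperQMS : Type (u + 1) where
  carrier : Type u
  [alg : NonUnitalCStarAlgebra carrier]
  L : LipSeminorm carrier
  M : NonUnitalStarSubalgebra ℂ carrier
  isProper : IsProperQMS L M
  base : Spec M

attribute [instance] PointedProperQMS.alg

/-- `Loc[A|M, (μ, r)]`. -/
def PointedProperQMS.locBall (A : PointedProperQMS.{u}) (r : ℝ) : Set A.carrier :=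
  Loc A.L A.M (specBall A.L A.M A.base r)

/-- `𝒮[A|μ, r]`. -/
def PointedProperQMS.statesBall (A : PointedProperQMS.{u}) (r : ℝ) : Set (State A.carrier) :=
  localStates A.M (specBall A.L A.M A.base r)

/-! ### Passages, tunnels, extents -/

/-- `π` is a topographic morphism from `(A, M)` to `(B, N)`: a *-epimorphism which maps `M` to `N`
and some approximate unit of `A` in `M` to an approximate unit of `B`. -/
structure IsTopographicMorphism {A B : Type u} [NonUnitalCStarAlgebra A] [NonUnitalCStarAlgebra B]
    (M : NonUnitalStarSubalgebra ℂ A) (N : NonUnitalStarSubalgebra ℂ B) (π : A →⋆ₙₐ[ℂ] B) :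
    Prop where
  surjective : Function.Surjective π
  map_mem : ∀ m ∈ M, π m ∈ N
  approxUnit : ∃ l : Filter A, l.IsApproximateUnit ∧ (M : Set A) ∈ l ∧
    (l.map π).IsApproximateUnit

/-- Passages from `A` to `B`. -/
structure Passage (A B : PointedProperQMS.{u}) : Type (u + 1) where
  carrier : Type u
  [alg : NonUnitalCStarAlgebra carrier]
  L : LipSeminorm carrier
  M : NonUnitalStarSubalgebra ℂ carrier
  locallyCompact : IsLocallyCompactQMS L M
  lowerSemi : LowerSemi L
  π : carrier →⋆ₙₐ[ℂ] A.carrier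
  ρ : carrier →⋆ₙₐ[ℂ] B.carrier
  topographic_π : IsTopographicMorphism M A.M π
  topographic_ρ : IsTopographicMorphism M B.M ρ

attribute [instance] Passage.alg

/-- The inverse passage. -/
def Passage.inv {A B : PointedProperQMS.{u}} (τ : Passage A B) : Passage B A where
  carrier := τ.carrier
  L := τ.L
  M := τ.M
  locallyCompact := τ.locallyCompact
  lowerSemi := τ.lowerSemi
  π := τ.ρ
  ρ := τ.π
  topographic_π := τ.topographic_ρ
  topographic_ρ := τ.topographic_π

/-- The image of the set of states `S` of `A` by the map `π^* : φ ↦ φ ∘ π`. -/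
def pullbackStates {D A : Type u} [NonUnitalCStarAlgebra D] [NonUnitalCStarAlgebra A] (π : D → A)
    (S : Set (State A)) : Set (State D) :=
  {ψ | ∃ φ ∈ S, ∀ d, ψ d = φ (π d)}

/-- The lift set of `a` for `τ` associated with `(l, r, ε, K)`. -/
def Passage.liftSet {A B : PointedProperQMS.{u}} (τ : Passage A B) (a : A.carrier) (l : ℝ≥0∞)
    (r ε : ℝ) (K : Set (Spec τ.M)) : Set τ.carrier :=
  {d | d ∈ Loc τ.L τ.M K ∧ τ.π d = a ∧ τ.ρ d ∈ B.locBall (r + 4 * ε) ∧ τ.L d ≤ l}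

/-- The target set of `a` for `τ` associated with `(l, r, ε, K)`. -/
def Passage.targetSet {A B : PointedProperQMS.{u}} (τ : Passage A B) (a : A.carrier) (l : ℝ≥0∞)
    (r ε : ℝ) (K : Set (Spec τ.M)) : Set B.carrier :=
  τ.ρ '' τ.liftSet a l r ε K

/-- `(ε, K)` is `r`-left admissible for `τ`. -/
structure Passage.LeftAdmissible {A B : PointedProperQMS.{u}} (τ : Passage A B) (r ε : ℝ)
    (K : Set (Spec τ.M)) : Prop where
  states_subset : pullbackStates τ.π (A.statesBall r) ⊆ localStates τ.M K
  almost_subset : ∀ φ ∈ localStates τ.M K,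
    ∃ ψ ∈ pullbackStates τ.π (A.statesBall (r + 4 * ε)),
      (mkMetric τ.L).edist φ ψ ≤ ENNReal.ofReal ε
  target_nonempty : ∀ a ∈ A.locBall r, (τ.targetSet a (A.L a) r ε K).Nonempty
  target_topography : ∀ a ∈ A.locBall r, a ∈ A.M →
    (τ.targetSet a (A.L a) r ε K ∩ (B.M : Set B.carrier)).Nonempty
  lip_le : ∀ d ∈ Loc τ.L τ.M K, B.L (τ.ρ d) ≤ τ.L d

/-- The Monge-Kantorovich distance on the spectrum of the topography of the passage between the
pull-backs `μ ∘ π` and `ν ∘ ρ` of the base points. -/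
def Passage.baseDist {A B : PointedProperQMS.{u}} (τ : Passage A B) : ℝ≥0∞ :=
  supDist {m : τ.M | τ.L (m : τ.carrier) ≤ 1}
    (fun m => A.base ⟨τ.π m, τ.topographic_π.map_mem m m.2⟩)
    (fun m => B.base ⟨τ.ρ m, τ.topographic_ρ.map_mem m m.2⟩)

/-- `(ε, K)` is `r`-admissible for `τ`. -/
structure Passage.AdmissiblePair {A B : PointedProperQMS.{u}} (τ : Passage A B) (r ε : ℝ)
    (K : Set (Spec τ.M)) : Prop where
  left : τ.LeftAdmissible r ε K
  right : τ.inv.LeftAdmissible r ε K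
  base : τ.baseDist ≤ ENNReal.ofReal ε
  leibniz : LeibnizOn τ.L (Loc τ.L τ.M K)

/-- The set of `r`-admissible numbers of a passage. -/
def Passage.Adm {A B : PointedProperQMS.{u}} (τ : Passage A B) (r : ℝ) : Set ℝ :=
  {ε | 0 < ε ∧ ∃ K : ℝ → Set (Spec τ.M),
    (∀ t ∈ Set.Ioc 0 r, IsCompact (K t)) ∧
    (∀ t ∈ Set.Ioc 0 r, ∀ t' ∈ Set.Ioc 0 r, t ≤ t' → K t ⊆ K t') ∧
    ∀ t ∈ Set.Ioc 0 r, τ.AdmissiblePair t ε (K t)}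

/-- A passage is an `r`-tunnel when it has `r`-admissible numbers. -/
def Passage.IsTunnel {A B : PointedProperQMS.{u}} (τ : Passage A B) (r : ℝ) : Prop :=
  (τ.Adm r).Nonempty

/-- The `r`-extent, the infimum of the `r`-admissible numbers. -/
def Passage.extent {A B : PointedProperQMS.{u}} (τ : Passage A B) (r : ℝ) : ℝ≥0∞ :=
  ⨅ ε ∈ τ.Adm r, ENNReal.ofReal ε

/-- The `r`-local propinquity, for the class of all tunnels. -/
def localPropinquity (r : ℝ) (A B : PointedProperQMS.{u}) : ℝ≥0∞ :=
  ⨅ (τ : Passage A B) (_ : τ.IsTunnel r), τ.extent r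

/-- The topographic Gromov-Hausdorff propinquity, for the class of all tunnels. -/
def propinquity (A B : PointedProperQMS.{u}) : ℝ≥0∞ :=
  min (⨅ (ε : ℝ) (_ : 0 < ε ∧ localPropinquity (1 / ε) A B < ENNReal.ofReal ε), ENNReal.ofReal ε)
    (ENNReal.ofReal (√2 / 4))

/-- The class of all limits, for the propinquity, of sequences in `S`. -/
def seqLimits (S : Set PointedProperQMS.{u}) : Set PointedProperQMS.{u} :=
  {B | ∃ A : ℕ → PointedProperQMS.{u}, (∀ n, A n ∈ S) ∧
    Tendsto (fun n => propinquity (A n) B) atTop (𝓝 0)}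

/-- The topographic Gromov-Hausdorff hypertopology: a class is closed when it contains the limits,
for the propinquity, of all of its sequences. -/
instance hypertopology : TopologicalSpace PointedProperQMS.{u} :=
  TopologicalSpace.ofClosed {S | seqLimits S ⊆ S}
    (by rintro B ⟨A, hA, -⟩; exact (hA 0).elim)
    (by
      rintro T hT B ⟨A, hA, hlim⟩ S hS
      exact hT hS ⟨A, fun n => hA n S hS, hlim⟩)
    (by
      rintro S hS T hT B ⟨A, hA, hlim⟩
      by_cases h : ∃ᶠ n in atTop, A n ∈ S
      · obtain ⟨k, hk, hkS⟩ := extraction_of_frequently_atTop h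
        exact Or.inl (hS ⟨A ∘ k, hkS, hlim.comp hk.tendsto_atTop⟩)
      · rw [not_frequently, eventually_atTop] at h
        obtain ⟨N, hN⟩ := h
        refine Or.inr (hT ⟨fun n => A (n + N), fun n => ?_, hlim.comp (tendsto_add_atTop_nat N)⟩)
        exact (hA (n + N)).resolve_left (hN _ (Nat.le_add_left N n)))

/-! ### Leibniz quantum compact metric spaces and the dual propinquity -/

/-- Leibniz quantum compact metric spaces. -/
structure LeibnizQCMS : Type (u + 1) where
  carrier : Type u
  [alg : CStarAlgebra carrier]
  [nontriv : Nontrivial carrier]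
  L : LipSeminorm carrier
  leibniz : LeibnizOn L Set.univ
  lowerSemi : LowerSemi L
  metrizes : mkTopology L = (inferInstance : TopologicalSpace (State carrier))

attribute [instance] LeibnizQCMS.alg LeibnizQCMS.nontriv

/-- Tunnels between Leibniz quantum compact metric spaces: *-epimorphisms `π`, `ρ` from a Leibniz
quantum compact metric space `D`, whose Lip-norm has the Lip-norms of `A` and `B` as quotients. -/
structure CompactTunnel (A B : LeibnizQCMS.{u}) : Type (u + 1) where
  D : LeibnizQCMS.{u}
  π : D.carrier →⋆ₐ[ℂ] A.carrier
  ρ : D.carrier →⋆ₐ[ℂ] B.carrier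
  surjective_π : Function.Surjective π
  surjective_ρ : Function.Surjective ρ
  quotient_π : ∀ a, IsSelfAdjoint a → A.L a = ⨅ (d) (_ : IsSelfAdjoint d ∧ π d = a), D.L d
  quotient_ρ : ∀ b, IsSelfAdjoint b → B.L b = ⨅ (d) (_ : IsSelfAdjoint d ∧ ρ d = b), D.L d

/-- The extent of a tunnel: the largest of the two Hausdorff distances, for the Monge-Kantorovich
metric, from `𝒮(D)` to the images of `𝒮(A)` and `𝒮(B)`. -/
def CompactTunnel.extent {A B : LeibnizQCMS.{u}} (τ : CompactTunnel A B) : ℝ≥0∞ :=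
  max (@Metric.hausdorffEDist _ (mkMetric τ.D.L) Set.univ (pullbackStates τ.π Set.univ))
    (@Metric.hausdorffEDist _ (mkMetric τ.D.L) Set.univ (pullbackStates τ.ρ Set.univ))

/-- The dual Gromov-Hausdorff propinquity. -/
def dualPropinquity (A B : LeibnizQCMS.{u}) : ℝ≥0∞ :=
  ⨅ τ : CompactTunnel A B, τ.extent


/-! ### The canonical pointed proper quantum metric space -/

/-- The trivial topography `ℂ1`. -/
def scalars (A : Type u) [CStarAlgebra A] : NonUnitalStarSubalgebra ℂ A where
  carrier := {a | ∃ t : ℂ, a = t • (1 : A)}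
  add_mem' := by rintro _ _ ⟨s, rfl⟩ ⟨t, rfl⟩; exact ⟨s + t, (add_smul _ _ _).symm⟩
  zero_mem' := ⟨0, (zero_smul _ _).symm⟩
  mul_mem' := by rintro _ _ ⟨s, rfl⟩ ⟨t, rfl⟩; exact ⟨s * t, by simp [smul_smul, mul_comm]⟩
  smul_mem' := by rintro c _ ⟨t, rfl⟩; exact ⟨c * t, smul_smul _ _ _⟩
  star_mem' := by rintro _ ⟨t, rfl⟩; exact ⟨star t, by simp⟩

theorem mem_scalars {A : Type u} [CStarAlgebra A] {a : A} :
    a ∈ scalars A ↔ ∃ t : ℂ, a = t • (1 : A) := Iff.rfl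

theorem smul_one_inj {A : Type u} [CStarAlgebra A] [Nontrivial A] {s t : ℂ}
    (h : s • (1 : A) = t • (1 : A)) : s = t :=
  smul_left_injective ℂ (one_ne_zero : (1 : A) ≠ 0) h

/-- The map `t1 ↦ t`. -/
def scalarPart {A : Type u} [CStarAlgebra A] (m : scalars A) : ℂ := m.2.choose

theorem eq_scalarPart {A : Type u} [CStarAlgebra A] (m : scalars A) :
    (m : A) = scalarPart m • (1 : A) := m.2.choose_spec

theorem scalarPart_eq {A : Type u} [CStarAlgebra A] [Nontrivial A] {m : scalars A} {t : ℂ}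
    (h : (m : A) = t • (1 : A)) : scalarPart m = t :=
  smul_one_inj ((eq_scalarPart m).symm.trans h)

/-- The map `t1 ↦ t` as a continuous linear functional on `ℂ1`. -/
def scalarCLM (A : Type u) [CStarAlgebra A] [Nontrivial A] : scalars A →L[ℂ] ℂ :=
  LinearMap.mkContinuous
    { toFun := scalarPart
      map_add' := fun m n => scalarPart_eq (by
        rw [add_smul, ← eq_scalarPart, ← eq_scalarPart]; rfl)
      map_smul' := fun c m => scalarPart_eq (by
        rw [RingHom.id_apply, smul_eq_mul, mul_smul, ← eq_scalarPart]; rfl) }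
    1 (fun m => by
      have h : ‖(m : A)‖ = ‖scalarPart m‖ := by
        conv_lhs => rw [eq_scalarPart m, norm_smul, norm_one, mul_one]
      rw [one_mul]
      exact h.ge)

/-- The base point `t1 ↦ t` of the spectrum of `ℂ1`. -/
def scalarPoint (A : Type u) [CStarAlgebra A] [Nontrivial A] : Spec (scalars A) :=
  ⟨StrongDual.toWeakDual (scalarCLM A), by
    refine ⟨fun h => ?_, fun m n => ?_⟩
    · have h1 : scalarPart (⟨1, 1, (one_smul _ _).symm⟩ : scalars A) = 0 :=
        DFunLike.congr_fun h (⟨1, 1, (one_smul _ _).symm⟩ : scalars A)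
      rw [scalarPart_eq (one_smul ℂ (1 : A)).symm] at h1
      exact one_ne_zero h1
    · refine scalarPart_eq (m := m * n) (t := scalarPart m * scalarPart n) ?_
      have : ((m * n : scalars A) : A) = (m : A) * (n : A) := rfl
      rw [this, eq_scalarPart m, eq_scalarPart n]
      simp only [smul_mul_smul_comm, mul_one]⟩

theorem spec_scalars_eq {A : Type u} [CStarAlgebra A] [Nontrivial A] (x : Spec (scalars A)) :
    x = scalarPoint A := by
  set e : scalars A := ⟨1, 1, (one_smul _ _).symm⟩ with he
  have hx : ∀ m : scalars A, x m = scalarPart m * x e := fun m => by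
    have h : m = scalarPart m • e := Subtype.ext (eq_scalarPart m)
    conv_lhs => rw [h]
    rw [map_smul, smul_eq_mul]
  have h2 : x e * x e = x e := by
    rw [← map_mul]
    congr 1
    exact Subtype.ext (mul_one 1)
  have h1 : x e = 1 := by
    by_cases h : x e = 0
    · exfalso
      refine x.2.1 (DFunLike.ext _ _ fun m => ?_)
      have := hx m
      rw [h, mul_zero] at this
      exact this
    · exact mul_left_cancel₀ h (h2.trans (mul_one _).symm)
  refine WeakDual.CharacterSpace.ext fun m => ?_
  rw [hx, h1, mul_one]
  rfl

theorem eq_one_of_mem_unitsOn_univ {A : Type u} [CStarAlgebra A] [Nontrivial A] {m : scalars A}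
    (hm : m ∈ unitsOn (scalars A) Set.univ) : (m : A) = 1 := by
  have h : scalarPart m = 1 := hm.2 (scalarPoint A) (Set.mem_univ _)
  rw [eq_scalarPart m, h, one_smul]

theorem isTopography_scalars (A : Type u) [CStarAlgebra A] : IsTopography (scalars A) where
  isClosed := by
    have h : ((scalars A : NonUnitalStarSubalgebra ℂ A) : Set A) =
        (Submodule.span ℂ {(1 : A)} : Submodule ℂ A) := by
      ext a
      simp only [SetLike.mem_coe, Submodule.mem_span_singleton, mem_scalars, eq_comm]
    rw [h]
    exact Submodule.closed_of_finiteDimensional _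
  comm := by
    rintro _ ⟨s, rfl⟩ _ ⟨t, rfl⟩
    simp [smul_smul, mul_comm]
  approxUnit := ⟨pure 1, Filter.IsApproximateUnit.pure_one A,
    show (1 : A) ∈ scalars A from ⟨1, (one_smul _ _).symm⟩⟩

/-- A functional of norm at most one on a unital C*-algebra which maps `1` to `1` is real on
self-adjoint elements. -/
theorem im_eq_zero_of_norm_le {A : Type u} [CStarAlgebra A] (f : StrongDual ℂ A) (hf : ‖f‖ ≤ 1)
    (h1 : f 1 = 1) (b : A) (hbs : IsSelfAdjoint b) : (f b).im = 0 := by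
  have hle : ∀ c : A, ‖f c‖ ≤ ‖c‖ := fun c =>
    (f.le_opNorm c).trans (mul_le_of_le_one_left (norm_nonneg c) hf)
  have hone : ‖(1 : A)‖ ≤ 1 := by
    rcases subsingleton_or_nontrivial A with h | h
    · rw [Subsingleton.elim (1 : A) 0, norm_zero]; exact zero_le_one
    · exact CStarRing.norm_one.le
  have key : ∀ t : ℝ, ((f b).im + t) ^ 2 ≤ ‖b‖ ^ 2 + t ^ 2 := fun t => by
    have e1 : f (b + ((t : ℂ) * Complex.I) • (1 : A)) = f b + (t : ℂ) * Complex.I := by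
      rw [map_add, map_smul, h1, smul_eq_mul, mul_one]
    have e2 : ‖b + ((t : ℂ) * Complex.I) • (1 : A)‖ ^ 2 ≤ ‖b‖ ^ 2 + t ^ 2 := by
      rw [sq, ← CStarRing.norm_star_mul_self]
      have e3 : star (b + ((t : ℂ) * Complex.I) • (1 : A)) * (b + ((t : ℂ) * Complex.I) • (1 : A))
          = b * b + ((t : ℂ) ^ 2) • (1 : A) := by
        rw [star_add, hbs.star_eq, star_smul, star_one]
        have : star ((t : ℂ) * Complex.I) = -((t : ℂ) * Complex.I) := by
          simp
        rw [this, add_mul, mul_add, mul_add, mul_smul_comm, smul_mul_assoc, smul_mul_smul_comm,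
          mul_one, one_mul, mul_one, neg_smul]
        have : -((t : ℂ) * Complex.I) * ((t : ℂ) * Complex.I) = (t : ℂ) ^ 2 := by
          linear_combination (-(t : ℂ) ^ 2) * Complex.I_sq
        rw [this]
        abel
      rw [e3]
      refine (norm_add_le _ _).trans (add_le_add ?_ ?_)
      · rw [sq]; exact norm_mul_le _ _
      · rw [norm_smul]
        have : ‖(t : ℂ) ^ 2‖ = t ^ 2 := by simp
        rw [this]
        exact mul_le_of_le_one_right (sq_nonneg t) hone
    have e4 := hle (b + ((t : ℂ) * Complex.I) • (1 : A))
    rw [e1] at e4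
    have e5 := Complex.abs_im_le_norm (f b + (t : ℂ) * Complex.I)
    have e6 : (f b + (t : ℂ) * Complex.I).im = (f b).im + t := by simp
    rw [e6] at e5
    calc ((f b).im + t) ^ 2 = |(f b).im + t| ^ 2 := (sq_abs _).symm
      _ ≤ ‖b + ((t : ℂ) * Complex.I) • (1 : A)‖ ^ 2 :=
        pow_le_pow_left₀ (abs_nonneg _) (e5.trans e4) 2
      _ ≤ _ := e2
  by_contra hne
  have h := key ((‖b‖ ^ 2 + 1) / (2 * (f b).im))
  have h2 : 2 * (f b).im * ((‖b‖ ^ 2 + 1) / (2 * (f b).im)) = ‖b‖ ^ 2 + 1 := by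
    field_simp
  nlinarith [sq_nonneg (f b).im]

/-- A functional of norm at most one on a unital C*-algebra which maps `1` to `1` is positive. -/
theorem positive_of_norm_le {A : Type u} [CStarAlgebra A] (f : StrongDual ℂ A) (hf : ‖f‖ ≤ 1)
    (h1 : f 1 = 1) (a : A) : 0 ≤ f (star a * a) := by
  set b := star a * a with hb
  have hbs : IsSelfAdjoint b := IsSelfAdjoint.star_mul_self a
  have hle : ∀ c : A, ‖f c‖ ≤ ‖c‖ := fun c =>
    (f.le_opNorm c).trans (mul_le_of_le_one_left (norm_nonneg c) hf)
  have hone : ‖(1 : A)‖ ≤ 1 := by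
    rcases subsingleton_or_nontrivial A with h | h
    · rw [Subsingleton.elim (1 : A) 0, norm_zero]; exact zero_le_one
    · exact CStarRing.norm_one.le
  have hre : 0 ≤ (f b).re := by
    let _ := CStarAlgebra.spectralOrder A
    have _ := CStarAlgebra.spectralOrderedRing A
    have hb0 : 0 ≤ b := star_mul_self_nonneg a
    have h3 : b ≤ algebraMap ℝ A ‖b‖ := IsSelfAdjoint.le_algebraMap_norm_self hbs
    have h4 : ‖algebraMap ℝ A ‖b‖ - b‖ ≤ ‖algebraMap ℝ A ‖b‖‖ :=
      CStarAlgebra.norm_le_norm_of_nonneg_of_le (sub_nonneg.2 h3) (sub_le_self _ hb0)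
    have h5 : ‖algebraMap ℝ A ‖b‖‖ ≤ ‖b‖ := by
      rw [Algebra.algebraMap_eq_smul_one, norm_smul, norm_norm]
      exact mul_le_of_le_one_right (norm_nonneg _) hone
    have h6 : f (algebraMap ℝ A ‖b‖ - b) = (‖b‖ : ℂ) - f b := by
      rw [map_sub, Algebra.algebraMap_eq_smul_one, ← Complex.coe_smul, map_smul, h1, smul_eq_mul,
        mul_one]
    have h7 := (hle _).trans (h4.trans h5)
    rw [h6] at h7
    have h8 := (Complex.re_le_norm _).trans h7
    simp only [Complex.sub_re, Complex.ofReal_re] at h8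
    linarith
  exact Complex.nonneg_iff.2 ⟨hre, (im_eq_zero_of_norm_le f hf h1 b hbs).symm⟩

/-- The norm of a self-adjoint element is attained at such a functional. -/
theorem exists_state_norm {A : Type u} [CStarAlgebra A] [Nontrivial A] (a : A)
    (ha : IsSelfAdjoint a) : ∃ f : StrongDual ℂ A, ‖f‖ ≤ 1 ∧ f 1 = 1 ∧ ‖f a‖ = ‖a‖ := by
  have : IsStarNormal a := ha.isStarNormal
  let B := StarAlgebra.elemental ℂ a
  let a' : B := ⟨a, StarAlgebra.elemental.self_mem ℂ a⟩
  have ha' : IsSelfAdjoint a' := Subtype.ext ha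
  obtain ⟨z, hz, hzn⟩ := spectrum.exists_nnnorm_eq_spectralRadius a'
  rw [ha'.spectralRadius_eq_nnnorm, ENNReal.coe_inj] at hzn
  obtain ⟨χ, rfl⟩ := WeakDual.CharacterSpace.mem_spectrum_iff_exists.1 hz
  let p : Submodule ℂ A := Subalgebra.toSubmodule B.toSubalgebra
  let g : StrongDual ℂ p := LinearMap.mkContinuous
    { toFun := fun x => χ (⟨x.1, x.2⟩ : B)
      map_add' := fun x y => map_add χ (⟨x.1, x.2⟩ : B) (⟨y.1, y.2⟩ : B)
      map_smul' := fun c x => map_smul χ c (⟨x.1, x.2⟩ : B) } 1 (fun x => by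
        rw [one_mul]
        have h := spectrum.norm_le_norm_of_mem
          (WeakDual.CharacterSpace.apply_mem_spectrum χ (⟨x.1, x.2⟩ : B))
        exact h)
  obtain ⟨f, hf, hfn⟩ := exists_extension_norm_eq p g
  refine ⟨f, hfn.trans_le (LinearMap.mkContinuous_norm_le _ zero_le_one _), ?_, ?_⟩
  · exact (hf ⟨1, one_mem B⟩).trans (map_one χ)
  · have h1 : f a = χ a' := hf ⟨a, a'.2⟩
    rw [h1]
    exact congrArg NNReal.toReal hzn

theorem separable_of_metrizes {A : Type u} [CStarAlgebra A] [Nontrivial A] (L : LipSeminorm A)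
    (h : mkTopology L = (inferInstance : TopologicalSpace (State A))) :
    TopologicalSpace.SeparableSpace A := by
  let T : Set (WeakDual ℂ A) :=
    (WeakDual.toStrongDual ⁻¹' Metric.closedBall 0 1) ∩ {φ | φ 1 = 1}
  have hT : IsCompact T := (WeakDual.isCompact_closedBall (0 : StrongDual ℂ A) 1).inter_right
    (isClosed_eq (WeakDual.eval_continuous (1 : A)) continuous_const)
  have hTn : ∀ φ ∈ T, ‖WeakDual.toStrongDual φ‖ ≤ 1 := fun φ hφ => by
    simpa using hφ.1
  let j : T → State A := fun φ => ⟨φ.1,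
    fun a => positive_of_norm_le (WeakDual.toStrongDual φ.1) (hTn _ φ.2) φ.2.2 a, by
      refine le_antisymm (hTn _ φ.2) ?_
      have h1 := (WeakDual.toStrongDual φ.1).le_opNorm 1
      have h2 : WeakDual.toStrongDual φ.1 1 = 1 := φ.2.2
      rwa [h2, norm_one, CStarRing.norm_one, mul_one] at h1⟩
  have hj : IsInducing j := by
    have h1 : IsInducing (Subtype.val : State A → WeakDual ℂ A) := IsInducing.subtypeVal
    refine IsInducing.of_comp_iff h1 |>.1 ?_
    exact IsInducing.subtypeVal
  have hS : TopologicalSpace.PseudoMetrizableSpace (State A) := by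
    have h1 : @TopologicalSpace.PseudoMetrizableSpace (State A) (mkTopology L) :=
      @PseudoEMetricSpace.pseudoMetrizableSpace (State A) (mkMetric L)
    rw [h] at h1
    exact h1
  have hTm : TopologicalSpace.PseudoMetrizableSpace T := hj.pseudoMetrizableSpace
  have hTc : CompactSpace T := isCompact_iff_compactSpace.1 hT
  let _ : PseudoMetricSpace T := TopologicalSpace.pseudoMetrizableSpacePseudoMetric T
  have hT2 : SecondCountableTopology T := inferInstance
  let Φ : A →ₗ[ℂ] C(T, ℂ) :=
    { toFun := fun a => ⟨fun φ => φ.1 a,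
        (WeakDual.eval_continuous a).comp continuous_subtype_val⟩
      map_add' := fun a b => ContinuousMap.ext fun φ => map_add φ.1 a b
      map_smul' := fun c a => ContinuousMap.ext fun φ => map_smul φ.1 c a }
  have hsa : ∀ a : A, IsSelfAdjoint a → ∀ b : A, IsSelfAdjoint b →
      ‖a‖ ≤ ‖Φ (a + Complex.I • b)‖ ∧ ‖b‖ ≤ ‖Φ (a + Complex.I • b)‖ := by
    intro a ha b hb
    have key : ∀ f : StrongDual ℂ A, ‖f‖ ≤ 1 → f 1 = 1 →
        ‖f a‖ ≤ ‖Φ (a + Complex.I • b)‖ ∧ ‖f b‖ ≤ ‖Φ (a + Complex.I • b)‖ := by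
      intro f hf h1
      let φ : T := ⟨StrongDual.toWeakDual f, by
        refine ⟨?_, h1⟩
        simpa using hf⟩
      have h2 : ‖f (a + Complex.I • b)‖ ≤ ‖Φ (a + Complex.I • b)‖ :=
        ContinuousMap.norm_coe_le_norm (Φ (a + Complex.I • b)) φ
      have ha0 := im_eq_zero_of_norm_le f hf h1 a ha
      have hb0 := im_eq_zero_of_norm_le f hf h1 b hb
      have ea : f a = ((f a).re : ℂ) := Complex.ext rfl (by simpa using ha0)
      have eb : f b = ((f b).re : ℂ) := Complex.ext rfl (by simpa using hb0)
      have e1 : (f (a + Complex.I • b)).re = (f a).re := by simp [hb0]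
      have e2 : (f (a + Complex.I • b)).im = (f b).re := by simp [ha0]
      rw [ea, eb, Complex.norm_real, Complex.norm_real, Real.norm_eq_abs, Real.norm_eq_abs]
      refine ⟨le_trans ?_ h2, le_trans ?_ h2⟩
      · rw [← e1]; exact Complex.abs_re_le_norm _
      · rw [← e2]; exact Complex.abs_im_le_norm _
    obtain ⟨f, hf, h1, hn⟩ := exists_state_norm a ha
    obtain ⟨g, hg, h1', hn'⟩ := exists_state_norm b hb
    exact ⟨hn ▸ (key f hf h1).1, hn' ▸ (key g hg h1').2⟩
  have hΦ : ∀ a : A, ‖a‖ ≤ 2 * ‖Φ a‖ := by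
    intro a
    have h1 := hsa (realPart a : A) (realPart a).2 (imaginaryPart a : A) (imaginaryPart a).2
    rw [realPart_add_I_smul_imaginaryPart] at h1
    calc ‖a‖ = ‖(realPart a : A) + Complex.I • (imaginaryPart a : A)‖ := by
          rw [realPart_add_I_smul_imaginaryPart]
      _ ≤ ‖(realPart a : A)‖ + ‖Complex.I • (imaginaryPart a : A)‖ := norm_add_le _ _
      _ ≤ 2 * ‖Φ a‖ := by
          rw [norm_smul, Complex.norm_I, one_mul]
          linarith [h1.1, h1.2]
  have hΦc : Continuous Φ := by
    refine (LinearMap.mkContinuous Φ 1 fun a => ?_).continuous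
    refine (ContinuousMap.norm_le _ (by positivity)).2 fun φ => ?_
    exact ((WeakDual.toStrongDual φ.1).le_opNorm a).trans
      (mul_le_mul_of_nonneg_right (hTn _ φ.2) (norm_nonneg a))
  have hind : IsInducing Φ := by
    have h2 : AntilipschitzWith 2 Φ :=
      AddMonoidHomClass.antilipschitz_of_bound Φ fun a => by simpa using hΦ a
    exact (h2.isUniformInducing
      (uniformContinuous_addMonoidHom_of_continuous (f := Φ.toAddMonoidHom) hΦc)).isInducing
  have := hind.secondCountableTopology
  infer_instance

theorem isProperQMS_scalars {A : Type u} [CStarAlgebra A] [Nontrivial A] (L : LipSeminorm A)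
    (leibniz : LeibnizOn L Set.univ) (lowerSemi : LowerSemi L)
    (h : mkTopology L = (inferInstance : TopologicalSpace (State A))) :
    IsProperQMS L (scalars A) := by
  have hK : IsCompact (Set.univ : Set (Spec (scalars A))) :=
    Set.Subsingleton.isCompact fun x _ y _ => (spec_scalars_eq x).trans (spec_scalars_eq y).symm
  have hloc : ∀ a, L a < ∞ → a ∈ LocStar L (scalars A) := fun a ha =>
    ⟨Set.univ, hK, ha, fun m hm => by rw [eq_one_of_mem_unitsOn_univ hm, one_mul, mul_one]⟩
  refine
    { locallyCompact := ⟨isTopography_scalars A, fun S _ => by rw [Metrizes, h]⟩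
      separable := separable_of_metrizes L h
      leibniz := leibniz
      lowerSemi := lowerSemi
      dense_loc := fun a ha => subset_closure (hloc a ha)
      dense_loc_topography := ?_
      proper := ⟨fun x y => ?_, fun x y _ => ?_, fun x r _ => ?_⟩ }
  · rintro a ⟨⟨t, rfl⟩, ha⟩
    refine subset_closure ⟨hloc _ ?_, ⟨t, rfl⟩⟩
    have ht : star t = t := smul_one_inj (A := A) (by simpa [IsSelfAdjoint] using ha)
    obtain ⟨s, rfl⟩ := Complex.conj_eq_iff_real.1 ht
    have h0 : L ((s : ℂ) • (1 : A)) = 0 :=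
      (L.eq_zero_iff _).2 (Or.inr ⟨1, s, fun b => ⟨one_mul b, mul_one b⟩, rfl⟩)
    rw [h0]
    exact ENNReal.zero_lt_top
  · rw [(spec_scalars_eq x).trans (spec_scalars_eq y).symm]
    rw [(specMetric L (scalars A)).edist_self]
    exact ENNReal.zero_ne_top
  · exact (spec_scalars_eq x).trans (spec_scalars_eq y).symm
  · exact @Set.Subsingleton.isCompact _ (_) _
      fun x _ y _ => (spec_scalars_eq x).trans (spec_scalars_eq y).symm

/-- The canonical pointed proper quantum metric space `(A, L, ℂ1, t1 ↦ t)` of a Leibniz quantum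
compact metric space `(A, L)`. -/
def LeibnizQCMS.toPointedProper (A : LeibnizQCMS.{u}) : PointedProperQMS.{u} where
  carrier := A.carrier
  L := A.L
  M := scalars A.carrier
  isProper := isProperQMS_scalars A.L A.leibniz A.lowerSemi A.metrizes
  base := scalarPoint A.carrier

end QuantumMetric

end

noncomputable section

namespace QuantumMetric

/-! ### Units of C*-algebras -/

/-- A C*-algebra with a unit is a unital C*-algebra. -/
theorem exists_cstarAlgebra {D : Type u} (inst : NonUnitalCStarAlgebra D) (e : D)
    (he : ∀ b, e * b = b ∧ b * e = b) :
    ∃ c : CStarAlgebra D, @CStarAlgebra.toNonUnitalCStarAlgebra D c = inst := by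
  let r : NormedRing D :=
    { (inferInstance : NonUnitalNormedRing D) with
      one := e
      one_mul := fun b => (he b).1
      mul_one := fun b => (he b).2 }
  let a : NormedAlgebra ℂ D :=
    { Algebra.ofModule (R := ℂ) (A := D) (fun c x y => smul_mul_assoc c x y)
        (fun c x y => mul_smul_comm c x y) with
      norm_smul_le := fun c x => norm_smul_le c x }
  exact ⟨{ r, a, inst with }, rfl⟩

/-- A subalgebra which is closed and contains the members of an approximate unit contains `1`. -/
theorem IsTopography.one_mem {A : Type u} [CStarAlgebra A] {M : NonUnitalStarSubalgebra ℂ A}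
    (hM : IsTopography M) : (1 : A) ∈ M := by
  obtain ⟨l, hl, hlM⟩ := hM.approxUnit
  have := hl.neBot
  have h := hl.tendsto_mul_right 1
  simp only [mul_one] at h
  exact hM.isClosed.mem_of_tendsto h hlM

theorem apply_one_spec {A : Type u} [CStarAlgebra A] {M : NonUnitalStarSubalgebra ℂ A}
    (h1 : (1 : A) ∈ M) (x : Spec M) : x ⟨1, h1⟩ = 1 := by
  have hmul : ∀ m : M, x m = x m * x ⟨1, h1⟩ := fun m => by
    rw [← map_mul]
    congr 1
    exact Subtype.ext (mul_one _).symm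
  by_contra h
  refine x.2.1 (DFunLike.ext _ _ fun m => ?_)
  have h2 := hmul ⟨1, h1⟩
  have h0 : x ⟨1, h1⟩ = 0 := by
    by_contra h0
    exact h (mul_left_cancel₀ h0 (h2.symm.trans (mul_one _).symm))
  have := hmul m
  rw [h0, mul_zero] at this
  exact this

/-- In an Abelian C*-algebra, the only square root of the unit which is nonnegative as a function
on the spectrum is the unit. -/
theorem eq_one_of_mul_self {A : Type u} [CStarAlgebra A] {M : NonUnitalStarSubalgebra ℂ A}
    (hM : IsTopography M) (m : M) (hm : ∀ x : Spec M, 0 ≤ x m)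
    (h : (m : A) * (m : A) = 1) : (m : A) = 1 := by
  let S : Subalgebra ℂ A :=
    { carrier := M
      mul_mem' := fun ha hb => mul_mem ha hb
      add_mem' := fun ha hb => add_mem ha hb
      algebraMap_mem' := fun c => by
        rw [Algebra.algebraMap_eq_smul_one]
        exact SMulMemClass.smul_mem c hM.one_mem }
  have : IsClosed (S : Set A) := hM.isClosed
  have : CompleteSpace S := this.completeSpace_coe
  let : NormedCommRing S :=
    { (inferInstance : NormedRing S) with
      mul_comm := fun a b => Subtype.ext (hM.comm a a.2 b b.2) }
  let m' : S := ⟨m, m.2⟩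
  have hm' : m' * m' = 1 := Subtype.ext h
  by_cases hs : (-1 : ℂ) ∈ spectrum ℂ m'
  · exfalso
    obtain ⟨f, hf⟩ := WeakDual.CharacterSpace.mem_spectrum_iff_exists.1 hs
    let i : M →L[ℂ] S := LinearMap.mkContinuous
      { toFun := fun n => ⟨n, n.2⟩
        map_add' := fun _ _ => rfl
        map_smul' := fun _ _ => rfl } 1 (fun n => by rw [one_mul]; exact le_rfl)
    let g : Spec M := ⟨StrongDual.toWeakDual ((WeakDual.toStrongDual f.1).comp i), by
      refine ⟨fun h0 => ?_, fun a b => map_mul f (i a) (i b)⟩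
      have h2 : f 1 = 0 := DFunLike.congr_fun h0 (⟨1, hM.one_mem⟩ : M)
      rw [map_one] at h2
      exact one_ne_zero h2⟩
    have h1 : g m = -1 := hf
    have h2 := hm g
    rw [h1, Complex.le_def] at h2
    norm_num at h2
  · rw [spectrum.notMem_iff] at hs
    have h1 : (algebraMap ℂ S (-1) - m') * (m' - 1) = 0 := by
      rw [map_neg, map_one]
      linear_combination -hm'
    have h2 := hs.mul_right_eq_zero.1 h1
    exact congrArg Subtype.val (sub_eq_zero.1 h2)

/-- If the unit is supported on `K`, then `1` is the only element of `unitsOn M K`. -/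
theorem eq_one_of_mem_unitsOn {A : Type u} [CStarAlgebra A] {M : NonUnitalStarSubalgebra ℂ A}
    (hM : IsTopography M) {K : Set (Spec M)} (hK : SupportedOn M K (1 : A)) {m : M}
    (hm : m ∈ unitsOn M K) : (m : A) = 1 :=
  eq_one_of_mul_self hM m (fun x => (hm.1 x).1) (by simpa using hK m hm)

theorem supportedOn_of_one {A : Type u} [CStarAlgebra A] {M : NonUnitalStarSubalgebra ℂ A}
    (hM : IsTopography M) {K : Set (Spec M)} (hK : SupportedOn M K (1 : A)) (a : A) :
    SupportedOn M K a := fun m hm => by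
  rw [eq_one_of_mem_unitsOn hM hK hm, one_mul, mul_one]

theorem SupportedOn.mono {A : Type u} [NonUnitalCStarAlgebra A] {M : NonUnitalStarSubalgebra ℂ A}
    {K K' : Set (Spec M)} (h : K ⊆ K') {a : A} (ha : SupportedOn M K a) : SupportedOn M K' a :=
  fun m hm => ha m ⟨hm.1, fun x hx => hm.2 x (h hx)⟩

/-! ### States of unital C*-algebras -/

section States

variable {A : Type u} [CStarAlgebra A]

theorem norm_le_of_positive (f : A →ₗ[ℂ] ℂ) (hf : ∀ a, 0 ≤ f (star a * a)) (a : A) :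
    ‖f a‖ ≤ (f 1).re * ‖a‖ := by
  let _ := CStarAlgebra.spectralOrder A
  have _ := CStarAlgebra.spectralOrderedRing A
  have hpos : ∀ b : A, 0 ≤ b → 0 ≤ f b := fun b hb => by
    obtain ⟨c, rfl⟩ := CStarAlgebra.nonneg_iff_eq_star_mul_self.1 hb
    exact hf c
  have h1 : 0 ≤ f 1 := by simpa using hf 1
  have h1' : ((f 1).re : ℂ) = f 1 := Complex.ext rfl (by simpa using (Complex.nonneg_iff.1 h1).2)
  have hsa : ∀ b : A, IsSelfAdjoint b → (f b).im = 0 ∧ (f b).re ≤ (f 1).re * ‖b‖ := fun b hb => by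
    have h2 : 0 ≤ f (algebraMap ℝ A ‖b‖ - b) :=
      hpos _ (sub_nonneg.2 (IsSelfAdjoint.le_algebraMap_norm_self hb))
    have h3 : f (algebraMap ℝ A ‖b‖) = ((f 1).re * ‖b‖ : ℝ) := by
      rw [Algebra.algebraMap_eq_smul_one, ← Complex.coe_smul, map_smul, smul_eq_mul,
        Complex.ofReal_mul, h1', mul_comm]
    rw [map_sub, h3, Complex.nonneg_iff] at h2
    simp only [Complex.sub_re, Complex.ofReal_re, Complex.sub_im, Complex.ofReal_im] at h2
    exact ⟨by linarith [h2.2], by linarith [h2.1]⟩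
  obtain ⟨c, hc, hcf⟩ : ∃ c : ℂ, ‖c‖ = 1 ∧ c * f a = ‖f a‖ := by
    obtain ⟨c, hc, h⟩ := RCLike.exists_norm_eq_mul_self (f a)
    exact ⟨c, hc, h.symm⟩
  have h4 : f (c • a) = ‖f a‖ := by rw [map_smul, smul_eq_mul, hcf]
  have hx : ‖c • a‖ = ‖a‖ := by rw [norm_smul, hc, one_mul]
  rw [← hx]
  clear hcf hx
  generalize c • a = x at h4 ⊢
  rw [← realPart_add_I_smul_imaginaryPart x, map_add, map_smul, smul_eq_mul] at h4
  have h5 := hsa (realPart x : A) (realPart x).2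
  have h6 := hsa (imaginaryPart x : A) (imaginaryPart x).2
  have h7 := congrArg Complex.re h4
  simp only [Complex.add_re, Complex.mul_re, Complex.I_re, Complex.I_im, Complex.ofReal_re,
    h6.1] at h7
  have h8 : ‖(realPart x : A)‖ ≤ ‖x‖ := realPart.norm_le x
  have h9 : 0 ≤ (f 1).re := (Complex.nonneg_iff.1 h1).1
  nlinarith [h5.2]

theorem State.norm_apply_le (φ : State A) (a : A) : ‖φ a‖ ≤ ‖a‖ := by
  have h := (WeakDual.toStrongDual φ.1).le_opNorm a
  rw [φ.2.2, one_mul] at h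
  exact h

theorem State.apply_one (φ : State A) : φ (1 : A) = 1 := by
  have h0 : 0 ≤ φ (1 : A) := by simpa using φ.2.1 1
  have h1 : ‖WeakDual.toStrongDual φ.1‖ ≤ (φ (1 : A)).re :=
    ContinuousLinearMap.opNorm_le_bound _ (Complex.nonneg_iff.1 h0).1
      (norm_le_of_positive ((WeakDual.toStrongDual φ.1 : StrongDual ℂ A) : A →ₗ[ℂ] ℂ) φ.2.1)
  rw [φ.2.2] at h1
  have hone : ‖(1 : A)‖ ≤ 1 := by
    rcases subsingleton_or_nontrivial A with h | h
    · rw [Subsingleton.elim (1 : A) 0, norm_zero]; exact zero_le_one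
    · exact CStarRing.norm_one.le
  have h2 := (Complex.re_le_norm _).trans ((φ.norm_apply_le 1).trans hone)
  exact Complex.ext (le_antisymm h2 h1) (Complex.nonneg_iff.1 h0).2.symm

theorem State.norm_le_one (φ : State A) : ‖WeakDual.toStrongDual φ.1‖ ≤ 1 := φ.2.2.le

theorem State.im_eq_zero (φ : State A) {a : A} (ha : IsSelfAdjoint a) : (φ a).im = 0 :=
  im_eq_zero_of_norm_le (WeakDual.toStrongDual φ.1) φ.norm_le_one φ.apply_one a ha

theorem State.ofReal_re (φ : State A) {a : A} (ha : IsSelfAdjoint a) :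
    (((φ a).re : ℝ) : ℂ) = φ a :=
  Complex.ext rfl (by simpa using (φ.im_eq_zero ha).symm)

variable [Nontrivial A]

/-- The state given by a functional of norm at most one which maps `1` to `1`. -/
def State.mk' (f : StrongDual ℂ A) (hf : ‖f‖ ≤ 1) (h1 : f 1 = 1) : State A :=
  ⟨StrongDual.toWeakDual f, positive_of_norm_le f hf h1, by
    refine le_antisymm hf ?_
    have h := f.le_opNorm 1
    rwa [h1, norm_one, CStarRing.norm_one, mul_one] at h⟩

theorem exists_state_norm_eq (a : A) (ha : IsSelfAdjoint a) : ∃ φ : State A, ‖φ a‖ = ‖a‖ := by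
  obtain ⟨f, hf, h1, h⟩ := exists_state_norm a ha
  exact ⟨State.mk' f hf h1, h⟩

instance : Nonempty (State A) := ⟨(exists_state_norm_eq (0 : A) (.zero A)).choose⟩

theorem State.isCompact_univ : IsCompact (Set.univ : Set (State A)) := by
  let T : Set (WeakDual ℂ A) :=
    (WeakDual.toStrongDual ⁻¹' Metric.closedBall 0 1) ∩ {φ | φ 1 = 1}
  have hT : IsCompact T := (WeakDual.isCompact_closedBall (0 : StrongDual ℂ A) 1).inter_right
    (isClosed_eq (WeakDual.eval_continuous (1 : A)) continuous_const)
  have h : (fun φ : State A => φ.1) '' Set.univ = T := by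
    ext φ
    constructor
    · rintro ⟨ψ, -, rfl⟩
      exact ⟨by simpa using State.norm_le_one ψ, State.apply_one ψ⟩
    · rintro ⟨h1, h2⟩
      exact ⟨State.mk' (WeakDual.toStrongDual φ) (by simpa using h1) h2, trivial, rfl⟩
  refine (IsInducing.isCompact_iff (f := fun φ : State A => φ.1) IsInducing.subtypeVal).2 ?_
  rw [h]
  exact hT

/-- The convex combination `t φ + (1 - t) ψ`. -/
theorem exists_state_convex (φ ψ : State A) {t : ℝ} (h0 : 0 ≤ t) (h1 : t ≤ 1) :
    ∃ χ : State A, ∀ a, χ a = t * φ a + (1 - t) * ψ a := by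
  refine ⟨State.mk' ((t : ℂ) • WeakDual.toStrongDual φ.1 +
    (1 - t : ℂ) • WeakDual.toStrongDual ψ.1) ?_ ?_, fun a => rfl⟩
  · refine (norm_add_le _ _).trans ?_
    rw [norm_smul, norm_smul, φ.2.2, ψ.2.2, mul_one, mul_one, ← Complex.ofReal_one,
      ← Complex.ofReal_sub, Complex.norm_real, Complex.norm_real, Real.norm_of_nonneg h0,
      Real.norm_of_nonneg (sub_nonneg.2 h1)]
    linarith
  · change (t : ℂ) * φ (1 : A) + (1 - t : ℂ) * ψ (1 : A) = 1
    rw [φ.apply_one, ψ.apply_one]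
    ring

/-- A positive functional is a multiple of a state. -/
theorem exists_state_smul (f : A →ₗ[ℂ] ℂ) (hf : ∀ a, 0 ≤ f (star a * a)) :
    ∃ φ : State A, ∀ a, f a = (f 1).re * φ a := by
  have h0 : 0 ≤ f 1 := by simpa using hf 1
  have h1 : ((f 1).re : ℂ) = f 1 := Complex.ext rfl (by simpa using (Complex.nonneg_iff.1 h0).2)
  have hre := (Complex.nonneg_iff.1 h0).1
  rcases hre.eq_or_lt with h | h
  · refine ⟨Classical.arbitrary _, fun a => ?_⟩
    have := norm_le_of_positive f hf a
    rw [← h] at this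
    change 0 = _ at h
    rw [← h]
    simpa using this
  · have h2 : ((f 1).re : ℂ) ≠ 0 := Complex.ofReal_ne_zero.2 (ne_of_gt h)
    refine ⟨State.mk' (LinearMap.mkContinuous (((f 1).re : ℂ)⁻¹ • f) 1 fun a => ?_)
      (LinearMap.mkContinuous_norm_le _ zero_le_one _) ?_, fun a => ?_⟩
    · have := norm_le_of_positive f hf a
      rw [LinearMap.smul_apply, norm_smul, norm_inv, Complex.norm_real, Real.norm_of_nonneg hre,
        one_mul]
      rw [inv_mul_le_iff₀ h]
      exact this
    · change ((f 1).re : ℂ)⁻¹ * f 1 = 1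
      rw [h1] at h2 ⊢
      exact inv_mul_cancel₀ h2
    · change f a = (f 1).re * (((f 1).re : ℂ)⁻¹ * f a)
      rw [mul_inv_cancel_left₀ h2]

end States

/-- The pull-back of a state by a unital *-morphism. -/
def State.comap {A D : Type u} [CStarAlgebra A] [CStarAlgebra D] [Nontrivial D]
    (φ : State A) (π : D →⋆ₐ[ℂ] A) : State D :=
  State.mk' (LinearMap.mkContinuous ((WeakDual.toStrongDual φ.1 : A →ₗ[ℂ] ℂ).comp
      (π.toAlgHom.toLinearMap)) 1 (fun d => by
        rw [one_mul]
        exact (φ.norm_apply_le (π d)).trans (NonUnitalStarAlgHom.norm_apply_le π d)))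
    (LinearMap.mkContinuous_norm_le _ zero_le_one _) (by
      change φ (π 1) = 1
      rw [map_one, φ.apply_one])

theorem State.comap_apply {A D : Type u} [CStarAlgebra A] [CStarAlgebra D]
    [Nontrivial D] (φ : State A) (π : D →⋆ₐ[ℂ] A) (d : D) : φ.comap π d = φ (π d) := rfl

/-! ### Lipschitz seminorms on unital C*-algebras -/

section Lip

variable {A : Type u} [CStarAlgebra A] (L : LipSeminorm A)

theorem LipSeminorm.isSelfAdjoint {a : A} (h : L a < ∞) : IsSelfAdjoint a := by
  by_contra h0
  rw [L.eq_top a h0] at h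
  exact lt_irrefl _ h

theorem LipSeminorm.map_real (t : ℝ) : L ((t : ℂ) • (1 : A)) = 0 :=
  (L.eq_zero_iff _).2 (Or.inr ⟨1, t, fun b => ⟨one_mul b, mul_one b⟩, rfl⟩)

theorem LipSeminorm.exists_of_eq_zero {a : A} (h : L a = 0) : ∃ t : ℝ, a = (t : ℂ) • (1 : A) := by
  rcases (L.eq_zero_iff a).1 h with rfl | ⟨e, t, he, rfl⟩
  · exact ⟨0, by simp⟩
  · exact ⟨t, by rw [← (he 1).1, mul_one]⟩

theorem LipSeminorm.sub_real_le (a : A) (t : ℝ) : L (a - (t : ℂ) • (1 : A)) ≤ L a := by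
  have h := L.add_le a (((-t : ℝ) : ℂ) • (1 : A))
  rwa [L.map_real, add_zero, Complex.ofReal_neg, neg_smul, ← sub_eq_add_neg] at h

theorem State.map_add (φ : State A) (a b : A) : φ (a + b) = φ a + φ b :=
  _root_.map_add (WeakDual.toStrongDual φ.1) a b

theorem State.map_sub (φ : State A) (a b : A) : φ (a - b) = φ a - φ b :=
  _root_.map_sub (WeakDual.toStrongDual φ.1) a b

theorem State.map_smul (φ : State A) (c : ℂ) (a : A) : φ (c • a) = c * φ a :=
  _root_.map_smul (WeakDual.toStrongDual φ.1) c a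

theorem State.map_real (φ : State A) (c : ℂ) : φ (c • (1 : A)) = c := by
  rw [φ.map_smul, φ.apply_one, mul_one]

theorem State.tendsto_iff {ι : Type*} {l : Filter ι} {χ : ι → State A} {φ : State A} :
    Tendsto χ l (𝓝 φ) ↔ ∀ a, Tendsto (fun i => χ i a) l (𝓝 (φ a)) :=
  (IsInducing.tendsto_nhds_iff (g := fun φ : State A => φ.1) IsInducing.subtypeVal).trans
    tendsto_iff_forall_eval_tendsto_topDualPairing

theorem isSelfAdjoint_real (t : ℝ) : IsSelfAdjoint ((t : ℂ) • (1 : A)) := by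
  rw [IsSelfAdjoint, star_smul, star_one]
  simp

theorem norm_sub_le_of_mk {φ ψ : State A} {a : A} {c δ : ℝ} (hc : 0 < c) (hδ : 0 ≤ δ)
    (ha : L a ≤ ENNReal.ofReal c) (h : (mkMetric L).edist φ ψ ≤ ENNReal.ofReal δ) :
    ‖φ a - ψ a‖ ≤ c * δ := by
  have h1 : L (((c⁻¹ : ℝ) : ℂ) • a) ≤ 1 := by
    rw [L.smul_eq, Real.enorm_eq_ofReal (inv_nonneg.2 hc.le)]
    calc _ ≤ ENNReal.ofReal c⁻¹ * ENNReal.ofReal c := by gcongr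
      _ = 1 := by rw [← ENNReal.ofReal_mul (inv_nonneg.2 hc.le), inv_mul_cancel₀ hc.ne',
        ENNReal.ofReal_one]
  have h2 : edist (φ (((c⁻¹ : ℝ) : ℂ) • a)) (ψ (((c⁻¹ : ℝ) : ℂ) • a)) ≤ ENNReal.ofReal δ :=
    (le_iSup₂ (f := fun a (_ : a ∈ {a | L a ≤ 1}) => edist (φ a) (ψ a)) _ h1).trans h
  rw [edist_dist, ENNReal.ofReal_le_ofReal_iff hδ, dist_eq_norm, State.map_smul, State.map_smul,
    ← mul_sub, norm_mul, Complex.norm_real, Real.norm_of_nonneg (inv_nonneg.2 hc.le),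
    inv_mul_le_iff₀ hc] at h2
  exact h2

theorem mk_le {φ ψ : State A} {δ : ℝ} (h : ∀ a, L a ≤ 1 → ‖φ a - ψ a‖ ≤ δ) :
    (mkMetric L).edist φ ψ ≤ ENNReal.ofReal δ :=
  iSup₂_le fun a ha => by
    rw [edist_dist, dist_eq_norm]
    exact ENNReal.ofReal_le_ofReal (h a ha)

theorem isClosed_lip (hls : LowerSemi L) {c : ℝ≥0∞} (hc : c < ∞) : IsClosed {a : A | L a ≤ c} := by
  have h := (lowerSemicontinuousOn_iff_preimage_Iic.1 hls) c
  obtain ⟨v, hv, h⟩ := h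
  have h2 : {a : A | L a ≤ c} = {a | IsSelfAdjoint a} ∩ v := by
    rw [← h]
    ext a
    exact ⟨fun ha => ⟨L.isSelfAdjoint (ha.trans_lt hc), ha⟩, fun ha => ha.2⟩
  rw [h2]
  exact IsClosed.inter (isClosed_eq continuous_star continuous_id) hv

theorem mk_ball_mem_nhds (hL : mkTopology L = (inferInstance : TopologicalSpace (State A)))
    (ψ : State A) {δ : ℝ} (hδ : 0 < δ) :
    {φ | (mkMetric L).edist φ ψ < ENNReal.ofReal δ} ∈ 𝓝 ψ := by
  have h : {φ | (mkMetric L).edist φ ψ < ENNReal.ofReal δ} ∈ @nhds _ (mkTopology L) ψ :=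
    @Metric.eball_mem_nhds _ (mkMetric L) ψ (ENNReal.ofReal δ) (ENNReal.ofReal_pos.2 hδ)
  rw [hL] at h
  exact h

/-- Rieffel's criterion: if the elements with `L a ≤ 1` are, up to real multiples of the unit, in a
totally bounded set, then the Monge-Kantorovich metric metrizes the weak* topology. -/
theorem metrizes_of_totallyBounded {S : Set A} (hS : TotallyBounded S)
    (h : ∀ a, L a ≤ 1 → ∃ t : ℝ, a - (t : ℂ) • (1 : A) ∈ S) :
    mkTopology L = (inferInstance : TopologicalSpace (State A)) := by
  refine le_antisymm (le_of_nhds_le_nhds fun φ => ?_) (le_of_nhds_le_nhds fun φ => ?_)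
  · have hsa : ∀ a, IsSelfAdjoint a →
        Tendsto (fun ψ : State A => ψ a) (@nhds _ (mkTopology L) φ) (𝓝 (φ a)) := by
      intro a ha
      refine Metric.tendsto_nhds.2 fun ε hε => ?_
      obtain ⟨b, hb, hab⟩ := Metric.mem_closure_iff.1 (L.dense_dom a ha) (ε / 4) (by positivity)
      let c : ℝ := (L b).toReal + 1
      have hc : 0 < c := by positivity
      have hbc : L b ≤ ENNReal.ofReal c :=
        ((ENNReal.lt_ofReal_iff_toReal_lt hb.ne).2 (lt_add_one _)).le
      refine Filter.mem_of_superset (@Metric.eball_mem_nhds _ (mkMetric L) φ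
        (ENNReal.ofReal (ε / (4 * c))) (ENNReal.ofReal_pos.2 (by positivity))) fun ψ hψ => ?_
      have h1 := norm_sub_le_of_mk L hc (by positivity) hbc (le_of_lt hψ)
      rw [show c * (ε / (4 * c)) = ε / 4 by field_simp] at h1
      rw [dist_eq_norm] at hab
      have h2 := (ψ.norm_apply_le (a - b)).trans hab.le
      have h3 := (φ.norm_apply_le (a - b)).trans hab.le
      rw [State.map_sub] at h2 h3
      change dist (ψ a) (φ a) < ε
      rw [dist_eq_norm]
      calc ‖ψ a - φ a‖ = ‖(ψ a - ψ b) + (ψ b - φ b) - (φ a - φ b)‖ := by congr 1; ring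
        _ ≤ ‖ψ a - ψ b‖ + ‖ψ b - φ b‖ + ‖φ a - φ b‖ :=
          (norm_sub_le _ _).trans (add_le_add_left (norm_add_le _ _) _)
        _ < ε := by linarith
    refine (State.tendsto_iff (χ := id) (l := @nhds _ (mkTopology L) φ)).2 fun a => ?_
    have h1 := (hsa _ (realPart a).2).add ((hsa _ (imaginaryPart a).2).const_mul Complex.I)
    have h2 : ∀ ψ : State A, ψ (realPart a : A) + Complex.I * ψ (imaginaryPart a : A) = ψ a :=
      fun ψ => by
        rw [← State.map_smul, ← State.map_add, realPart_add_I_smul_imaginaryPart]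
    rw [h2] at h1
    exact h1.congr h2
  · intro V hV
    obtain ⟨ε, hε, hεV⟩ := (@EMetric.mem_nhds_iff _ (mkMetric L) φ V).1 hV
    obtain ⟨r, hr0, hr, hrε⟩ := ENNReal.lt_iff_exists_real_btwn.1 hε
    have hr' : 0 < r := ENNReal.ofReal_pos.1 hr
    obtain ⟨t, ht, htS⟩ := Metric.totallyBounded_iff.1 hS (r / 3) (by positivity)
    have h1 : {ψ : State A | ∀ y ∈ t, ‖ψ y - φ y‖ < r / 3} ∈ 𝓝 φ := by
      have h2 := (Filter.biInter_mem (f := 𝓝 φ)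
        (s := fun y => {ψ : State A | ‖ψ y - φ y‖ < r / 3}) ht).2 fun y _ => by
          have h3 := Metric.tendsto_nhds.1 (State.tendsto_iff.1 (tendsto_id (x := 𝓝 φ)) y)
            (r / 3) (by positivity)
          simp only [dist_eq_norm] at h3
          exact h3
      refine Filter.mem_of_superset h2 fun ψ hψ y hy => ?_
      exact Set.mem_iInter₂.1 hψ y hy
    refine Filter.mem_of_superset h1 fun ψ hψ => hεV ?_
    refine lt_of_le_of_lt (mk_le L (δ := r) fun a ha => ?_) hrε
    obtain ⟨s, hs⟩ := h a ha
    obtain ⟨y, hy, hys⟩ := Set.mem_iUnion₂.1 (htS hs)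
    rw [Metric.mem_ball, dist_eq_norm] at hys
    have h2 := (ψ.norm_apply_le _).trans hys.le
    have h3 := (φ.norm_apply_le _).trans hys.le
    have h4 := hψ y hy
    rw [State.map_sub, State.map_sub, State.map_real] at h2 h3
    calc ‖ψ a - φ a‖ = ‖(ψ a - s - ψ y) + (ψ y - φ y) - (φ a - s - φ y)‖ := by congr 1; ring
      _ ≤ ‖ψ a - s - ψ y‖ + ‖ψ y - φ y‖ + ‖φ a - s - φ y‖ :=
        (norm_sub_le _ _).trans (add_le_add_left (norm_add_le _ _) _)
      _ ≤ r := by linarith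

variable [Nontrivial A]

theorem norm_le_of_states {a : A} (ha : IsSelfAdjoint a) {C : ℝ} (h : ∀ φ : State A, ‖φ a‖ ≤ C) :
    ‖a‖ ≤ C := by
  obtain ⟨φ, hφ⟩ := exists_state_norm_eq a ha
  exact hφ ▸ h φ

theorem mk_ne_top (hL : mkTopology L = (inferInstance : TopologicalSpace (State A)))
    (φ ψ : State A) : (mkMetric L).edist φ ψ ≠ ∞ := by
  choose χ hχ using fun n : ℕ => exists_state_convex φ ψ (t := 1 / ((n : ℝ) + 1)) (by positivity)
    (by rw [div_le_one (by positivity)]; linarith [(Nat.cast_nonneg n : (0 : ℝ) ≤ n)])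
  have h1 : Tendsto χ atTop (𝓝 ψ) := by
    refine State.tendsto_iff.2 fun a => ?_
    have h2 : Tendsto (fun n : ℕ => ((1 / ((n : ℝ) + 1) : ℝ) : ℂ)) atTop (𝓝 ((0 : ℝ) : ℂ)) :=
      (Complex.continuous_ofReal.tendsto _).comp tendsto_one_div_add_atTop_nhds_zero_nat
    have h3 := (h2.mul_const (φ a)).add
      (((tendsto_const_nhds (x := (1 : ℂ))).sub h2).mul_const (ψ a))
    simp only [Complex.ofReal_zero, zero_mul, zero_add] at h3
    rw [show (1 - 0 : ℂ) * ψ a = ψ a by ring] at h3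
    exact h3.congr fun n => (hχ n a).symm
  obtain ⟨n, hn⟩ := (h1.eventually (mk_ball_mem_nhds L hL ψ one_pos)).exists
  have hn' : (mkMetric L).edist (χ n) ψ ≤ ENNReal.ofReal 1 := by
    exact le_of_lt hn
  refine ne_top_of_le_ne_top ENNReal.ofReal_ne_top (mk_le L (δ := (n : ℝ) + 1) fun a ha => ?_)
  have h3 := norm_sub_le_of_mk L one_pos zero_le_one (by simpa using ha) hn'
  have hpos : (0 : ℝ) < (n : ℝ) + 1 := by positivity
  rw [hχ, show ((1 / ((n : ℝ) + 1) : ℝ) : ℂ) * φ a + (1 - ((1 / ((n : ℝ) + 1) : ℝ) : ℂ)) * ψ a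
    - ψ a = ((1 / ((n : ℝ) + 1) : ℝ) : ℂ) * (φ a - ψ a) by ring, norm_mul, Complex.norm_real,
    Real.norm_of_nonneg (by positivity), one_div, inv_mul_le_iff₀ hpos] at h3
  simpa using h3

/-- The state space is covered by finitely many balls of a given radius. -/
theorem exists_finite_net (hL : mkTopology L = (inferInstance : TopologicalSpace (State A)))
    {δ : ℝ} (hδ : 0 < δ) : ∃ t : Finset (State A), ∀ φ : State A, ∃ ψ ∈ t,
      (mkMetric L).edist φ ψ ≤ ENNReal.ofReal δ := by
  obtain ⟨t, -, ht⟩ := (State.isCompact_univ (A := A)).elim_nhds_subcover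
    (fun ψ => {φ | (mkMetric L).edist φ ψ < ENNReal.ofReal δ})
    (fun ψ _ => mk_ball_mem_nhds L hL ψ hδ)
  refine ⟨t, fun φ => ?_⟩
  obtain ⟨ψ, hψ, h⟩ := Set.mem_iUnion₂.1 (ht (Set.mem_univ φ))
  exact ⟨ψ, hψ, le_of_lt h⟩

/-- The Monge-Kantorovich metric of a quantum compact metric space is bounded. -/
theorem exists_mk_le (hL : mkTopology L = (inferInstance : TopologicalSpace (State A))) :
    ∃ C : ℝ, 0 ≤ C ∧ ∀ φ ψ : State A, (mkMetric L).edist φ ψ ≤ ENNReal.ofReal C := by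
  obtain ⟨t, ht⟩ := exists_finite_net L hL one_pos
  have φ₀ : State A := Classical.arbitrary _
  let s : ℝ≥0∞ := ∑ χ ∈ t, (mkMetric L).edist χ φ₀
  have hs : s ≠ ∞ := ENNReal.sum_ne_top.2 fun χ _ => mk_ne_top L hL χ φ₀
  have h1 : ∀ φ, (mkMetric L).edist φ φ₀ ≤ 1 + s := fun φ => by
    obtain ⟨χ, hχ, h⟩ := ht φ
    refine ((mkMetric L).edist_triangle φ χ φ₀).trans (add_le_add (by simpa using h) ?_)
    exact Finset.single_le_sum (f := fun χ => (mkMetric L).edist χ φ₀) (fun _ _ => zero_le) hχ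
  refine ⟨((1 + s) + (1 + s)).toReal, ENNReal.toReal_nonneg, fun φ ψ => ?_⟩
  rw [ENNReal.ofReal_toReal (by finiteness)]
  refine ((mkMetric L).edist_triangle φ φ₀ ψ).trans (add_le_add (h1 φ) ?_)
  rw [(mkMetric L).edist_comm]
  exact h1 ψ

theorem exists_norm_sub_le (hL : mkTopology L = (inferInstance : TopologicalSpace (State A))) :
    ∃ C : ℝ, 0 ≤ C ∧ ∀ (a : A) (c : ℝ), 0 < c → L a ≤ ENNReal.ofReal c →
      ∃ t : ℝ, ‖a - (t : ℂ) • (1 : A)‖ ≤ c * C := by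
  obtain ⟨C, hC, h⟩ := exists_mk_le L hL
  refine ⟨C, hC, fun a c hc ha => ?_⟩
  have φ₀ : State A := Classical.arbitrary _
  have hsa := L.isSelfAdjoint (ha.trans_lt ENNReal.ofReal_lt_top)
  refine ⟨(φ₀ a).re, norm_le_of_states (hsa.sub (isSelfAdjoint_real _)) fun φ => ?_⟩
  rw [φ.map_sub, φ.map_real, φ₀.ofReal_re hsa]
  exact norm_sub_le_of_mk L hc hC ha (h φ φ₀)

theorem totallyBounded_lip (hL : mkTopology L = (inferInstance : TopologicalSpace (State A)))
    {c : ℝ} (hc : 0 < c) (R : ℝ) : TotallyBounded {a : A | L a ≤ ENNReal.ofReal c ∧ ‖a‖ ≤ R} := by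
  refine Metric.totallyBounded_of_finite_discretization fun ε hε => ?_
  obtain ⟨t, ht⟩ := exists_finite_net L hL (δ := ε / (8 * c)) (by positivity)
  let F : A → (t → ℂ) := fun a ψ => ψ.1 a
  have hb : TotallyBounded
      (Set.range fun a : {a : A | L a ≤ ENNReal.ofReal c ∧ ‖a‖ ≤ R} => F a) := by
    refine (isCompact_closedBall (0 : t → ℂ) |R|).totallyBounded.subset ?_
    rintro _ ⟨a, rfl⟩
    rw [mem_closedBall_zero_iff]
    refine (pi_norm_le_iff_of_nonneg (abs_nonneg _)).2 fun ψ => ?_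
    exact ((State.norm_apply_le ψ.1 a.1).trans a.2.2).trans (le_abs_self R)
  obtain ⟨s, hs, hs'⟩ := Metric.totallyBounded_iff.1 hb (ε / 8) (by positivity)
  have : Fintype s := hs.fintype
  choose G hG using fun a : {a : A | L a ≤ ENNReal.ofReal c ∧ ‖a‖ ≤ R} =>
    Set.mem_iUnion₂.1 (hs' (Set.mem_range_self a))
  choose hG1 hG2 using hG
  refine ⟨ULift s, inferInstance, fun a => ⟨⟨G a, hG1 a⟩⟩, fun a b hab => ?_⟩
  have hab' : G a = G b := congrArg (fun x : ULift s => x.down.1) hab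
  have h1 : dist (F a) (F b) < ε / 4 := by
    have h2 := hG2 a
    have h3 := hG2 b
    rw [hab'] at h2
    rw [Metric.mem_ball] at h2 h3
    rw [dist_comm] at h3
    linarith [dist_triangle (F a) (G b) (F b)]
  have hsa := (L.isSelfAdjoint (a.2.1.trans_lt ENNReal.ofReal_lt_top)).sub
    (L.isSelfAdjoint (b.2.1.trans_lt ENNReal.ofReal_lt_top))
  rw [dist_eq_norm]
  refine lt_of_le_of_lt (norm_le_of_states (C := ε / 2) hsa fun φ => ?_) (half_lt_self hε)
  obtain ⟨ψ, hψ, h⟩ := ht φ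
  have ha := norm_sub_le_of_mk L hc (by positivity) a.2.1 h
  have hb := norm_sub_le_of_mk L hc (by positivity) b.2.1 h
  rw [show c * (ε / (8 * c)) = ε / 8 by field_simp] at ha hb
  have h4 : ‖ψ a.1 - ψ b.1‖ ≤ ε / 4 := by
    have h5 := dist_le_pi_dist (F a) (F b) ⟨ψ, hψ⟩
    rw [dist_eq_norm] at h5
    exact h5.trans h1.le
  rw [φ.map_sub]
  calc ‖φ a.1 - φ b.1‖ = ‖(φ a.1 - ψ a.1) + (ψ a.1 - ψ b.1) - (φ b.1 - ψ b.1)‖ := by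
        congr 1; ring
    _ ≤ ‖φ a.1 - ψ a.1‖ + ‖ψ a.1 - ψ b.1‖ + ‖φ b.1 - ψ b.1‖ :=
        (norm_sub_le _ _).trans (add_le_add_left (norm_add_le _ _) _)
    _ ≤ ε / 2 := by linarith

theorem isCompact_lip (hL : mkTopology L = (inferInstance : TopologicalSpace (State A)))
    (hls : LowerSemi L) {c : ℝ} (hc : 0 < c) (R : ℝ) :
    IsCompact {a : A | L a ≤ ENNReal.ofReal c ∧ ‖a‖ ≤ R} :=
  (totallyBounded_lip L hL hc R).isCompact_of_isClosed
    ((isClosed_lip L hls ENNReal.ofReal_lt_top).inter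
      (isClosed_le continuous_norm continuous_const))

/-- The infimum which defines a quotient seminorm is attained. -/
theorem exists_lift (hL : mkTopology L = (inferInstance : TopologicalSpace (State A)))
    (hls : LowerSemi L) {B : Type u} [CStarAlgebra B] [Nontrivial B] (LB : LipSeminorm B)
    (π : A →⋆ₐ[ℂ] B)
    (hq : ∀ b, IsSelfAdjoint b → LB b = ⨅ (d) (_ : IsSelfAdjoint d ∧ π d = b), L d)
    {b : B} (hb : LB b < ∞) : ∃ d, π d = b ∧ L d ≤ LB b := by
  obtain ⟨C, hC, hCt⟩ := exists_norm_sub_le L hL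
  let c : ℝ := (LB b).toReal + 1
  have hc : 0 < c := by positivity
  have hbc : LB b < ENNReal.ofReal c :=
    (ENNReal.lt_ofReal_iff_toReal_lt hb.ne).2 (lt_add_one _)
  have hsb := LB.isSelfAdjoint hb
  have hnorm : ∀ d, π d = b → L d ≤ ENNReal.ofReal c → ‖d‖ ≤ ‖b‖ + 2 * (c * C) := by
    intro d hd hLd
    obtain ⟨t, ht⟩ := hCt d c hc hLd
    have h1 : ‖b - (t : ℂ) • (1 : B)‖ ≤ c * C := by
      have h2 := NonUnitalStarAlgHom.norm_apply_le π (d - (t : ℂ) • (1 : A))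
      rw [map_sub, map_smul, map_one, hd] at h2
      exact h2.trans ht
    have h2 : ‖(t : ℂ) • (1 : B)‖ ≤ ‖b‖ + c * C := by
      have := norm_sub_le b (b - (t : ℂ) • (1 : B))
      rw [sub_sub_cancel] at this
      linarith
    have h3 : ‖(t : ℂ) • (1 : A)‖ = ‖(t : ℂ) • (1 : B)‖ := by
      rw [norm_smul, norm_smul, CStarRing.norm_one, CStarRing.norm_one]
    have h4 := norm_add_le (d - (t : ℂ) • (1 : A)) ((t : ℂ) • (1 : A))
    rw [sub_add_cancel] at h4
    linarith
  let s : Set A := {a | L a ≤ ENNReal.ofReal c ∧ ‖a‖ ≤ ‖b‖ + 2 * (c * C)} ∩ {d | π d = b}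
  have hπc : Continuous π :=
    AddMonoidHomClass.continuous_of_bound π 1 fun d => by
      rw [one_mul]
      exact NonUnitalStarAlgHom.norm_apply_le π d
  have hs : IsCompact s :=
    (isCompact_lip L hL hls hc _).inter_right (isClosed_eq hπc continuous_const)
  have hne : s.Nonempty := by
    have h := hbc
    rw [hq b hsb, iInf_lt_iff] at h
    obtain ⟨d, hd⟩ := h
    obtain ⟨⟨-, hd2⟩, hd3⟩ := iInf_lt_iff.1 hd
    exact ⟨d, ⟨hd3.le, hnorm d hd2 hd3.le⟩, hd2⟩
  obtain ⟨d, hd, hmin⟩ := LowerSemicontinuousOn.exists_isMinOn hne hs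
    (hls.mono fun a ha => L.isSelfAdjoint (ha.1.1.trans_lt ENNReal.ofReal_lt_top))
  refine ⟨d, hd.2, ?_⟩
  rw [hq b hsb]
  refine le_iInf₂ fun d' hd' => ?_
  by_cases h : L d' ≤ ENNReal.ofReal c
  · exact hmin ⟨⟨h, hnorm d' hd'.2 h⟩, hd'.2⟩
  · exact hd.1.1.trans (not_le.1 h).le

end Lip

/-! ### Comparison of the propinquities on quantum compact metric spaces -/

theorem metrizes_of_supportedOn_one {D : Type u} [CStarAlgebra D] {L : LipSeminorm D}
    {M : NonUnitalStarSubalgebra ℂ D} (h : IsLocallyCompactQMS L M) {K : Set (Spec M)}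
    (hK : IsCompact K) (h1 : SupportedOn M K (1 : D)) :
    mkTopology L = (inferInstance : TopologicalSpace (State D)) := by
  have hM := h.topography
  have ht : Tame L M (Set.univ : Set (State D)) := fun ε hε => ⟨K, hK, fun K' _ hKK' φ _ a _ =>
    ⟨φ a, fun δ hδ => ⟨⟨1, hM.one_mem⟩,
      ⟨fun x => by rw [apply_one_spec]; exact ⟨zero_le_one, le_rfl⟩,
        fun x _ => apply_one_spec _ x⟩, fun m hm _ => by
          rw [eq_one_of_mem_unitsOn hM (h1.mono hKK') hm, one_mul, mul_one, sub_self, norm_zero]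
          exact hδ⟩, by rw [sub_self, norm_zero]; exact hε.le⟩⟩
  have h2 := h.metrizes _ ht
  have h3 := congrArg (TopologicalSpace.induced fun φ : State D => (⟨φ, trivial⟩ :
    (Set.univ : Set (State D)))) h2
  rw [induced_compose, induced_compose] at h3
  exact (@induced_id _ (mkTopology L)).symm.trans (h3.trans (@induced_id _ _))

theorem localStates_eq_univ {D : Type u} [CStarAlgebra D] {M : NonUnitalStarSubalgebra ℂ D}
    (hM : IsTopography M) {K : Set (Spec M)} (h1 : SupportedOn M K (1 : D)) :
    localStates M K = Set.univ :=
  Set.eq_univ_of_forall fun φ m hm => by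
    rw [eq_one_of_mem_unitsOn hM h1 hm]
    exact φ.apply_one

namespace LeibnizQCMS

variable (A : LeibnizQCMS.{u})

theorem specBall_toPointedProper (r : ℝ) :
    specBall A.toPointedProper.L A.toPointedProper.M A.toPointedProper.base r = Set.univ :=
  Set.eq_univ_of_forall fun x => by
    have hx : x = A.toPointedProper.base := spec_scalars_eq (A := A.carrier) x
    rw [hx]
    change (specMetric _ _).edist _ _ ≤ _
    rw [(specMetric _ _).edist_self]
    exact zero_le

theorem supportedOn_univ (a : A.carrier) : SupportedOn (scalars A.carrier) Set.univ a :=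
  fun m hm => by rw [eq_one_of_mem_unitsOn_univ hm, one_mul, mul_one]

theorem mem_locBall {a : A.carrier} (ha : A.L a < ∞) (r : ℝ) : a ∈ A.toPointedProper.locBall r := by
  rw [PointedProperQMS.locBall, specBall_toPointedProper]
  exact ⟨ha, A.supportedOn_univ a⟩

theorem statesBall_eq_univ (r : ℝ) : A.toPointedProper.statesBall r = Set.univ := by
  rw [PointedProperQMS.statesBall, specBall_toPointedProper]
  exact localStates_eq_univ (D := A.carrier) (isTopography_scalars _) (A.supportedOn_univ 1)

end LeibnizQCMS

namespace CompactTunnel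

variable {A B : LeibnizQCMS.{u}} (τ : CompactTunnel A B)

/-- The inverse tunnel. -/
def inv : CompactTunnel B A :=
  ⟨τ.D, τ.ρ, τ.π, τ.surjective_ρ, τ.surjective_π, τ.quotient_ρ, τ.quotient_π⟩

theorem le_left (d : τ.D.carrier) : A.L (τ.π d) ≤ τ.D.L d := by
  by_cases h : IsSelfAdjoint d
  · rw [τ.quotient_π _ (h.map τ.π)]
    exact iInf₂_le d ⟨h, rfl⟩
  · rw [τ.D.L.eq_top d h]
    exact le_top

theorem exists_lift {a : A.carrier} (ha : A.L a < ∞) : ∃ d, τ.π d = a ∧ τ.D.L d ≤ A.L a :=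
  QuantumMetric.exists_lift τ.D.L τ.D.metrizes τ.D.lowerSemi A.L τ.π τ.quotient_π ha

theorem exists_near {ε : ℝ} (h : τ.extent < ENNReal.ofReal ε) (φ : State τ.D.carrier) :
    ∃ ψ : State A.carrier, (mkMetric τ.D.L).edist φ (ψ.comap τ.π) ≤ ENNReal.ofReal ε := by
  obtain ⟨χ, ⟨ψ, -, hχ⟩, h1⟩ := @Metric.exists_edist_lt_of_hausdorffEDist_lt _ (mkMetric τ.D.L)
    _ _ _ _ (Set.mem_univ φ) ((le_max_left _ _).trans_lt h)
  refine ⟨ψ, ?_⟩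
  have : ψ.comap τ.π = χ := Subtype.ext (DFunLike.ext _ _ fun d => (hχ d).symm)
  rw [this]
  exact h1.le

theorem extent_inv : τ.inv.extent = τ.extent := max_comm _ _

theorem isTopographicMorphism_scalars {D A : Type u} [CStarAlgebra D] [CStarAlgebra A]
    (π : D →⋆ₐ[ℂ] A) (hπ : Function.Surjective π) :
    IsTopographicMorphism (scalars D) (scalars A) (π : D →⋆ₙₐ[ℂ] A) where
  surjective := hπ
  map_mem := by
    rintro _ ⟨t, rfl⟩
    exact ⟨t, by simp⟩
  approxUnit := ⟨pure 1, Filter.IsApproximateUnit.pure_one D,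
    show (1 : D) ∈ scalars D from ⟨1, (one_smul _ _).symm⟩, by
      rw [Filter.map_pure]
      change (pure (π 1) : Filter A).IsApproximateUnit
      rw [map_one]
      exact Filter.IsApproximateUnit.pure_one A⟩

/-- A tunnel between quantum compact metric spaces as a passage. -/
def toPassage : Passage A.toPointedProper B.toPointedProper where
  carrier := τ.D.carrier
  L := τ.D.L
  M := scalars τ.D.carrier
  locallyCompact :=
    (isProperQMS_scalars τ.D.L τ.D.leibniz τ.D.lowerSemi τ.D.metrizes).locallyCompact
  lowerSemi := τ.D.lowerSemi
  π := (τ.π : τ.D.carrier →⋆ₙₐ[ℂ] A.carrier)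
  ρ := (τ.ρ : τ.D.carrier →⋆ₙₐ[ℂ] B.carrier)
  topographic_π := isTopographicMorphism_scalars τ.π τ.surjective_π
  topographic_ρ := isTopographicMorphism_scalars τ.ρ τ.surjective_ρ

theorem leftAdmissible {r ε : ℝ} (h : τ.extent < ENNReal.ofReal ε) :
    τ.toPassage.LeftAdmissible r ε Set.univ where
  states_subset := fun φ _ => by
    have := localStates_eq_univ (D := τ.D.carrier) (isTopography_scalars _)
      (τ.D.supportedOn_univ 1)
    exact this.ge (Set.mem_univ φ)
  almost_subset := fun φ _ => by
    obtain ⟨ψ, hψ⟩ := τ.exists_near h φ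
    exact ⟨State.comap (D := τ.D.carrier) ψ τ.π,
      ⟨ψ, (A.statesBall_eq_univ _).ge (Set.mem_univ ψ), fun d => rfl⟩, hψ⟩
  target_nonempty := fun a ha => by
    obtain ⟨d, hd, hL⟩ := τ.exists_lift ha.1
    have hLd := hL.trans_lt ha.1
    exact ⟨τ.ρ d, d, ⟨⟨hLd, τ.D.supportedOn_univ d⟩, hd,
      B.mem_locBall ((τ.inv.le_left d).trans_lt hLd) _, hL⟩, rfl⟩
  target_topography := fun a ha haM => by
    obtain ⟨t, rfl⟩ := haM
    have ht : star t = t := smul_one_inj (A := A.carrier) (by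
      have := A.L.isSelfAdjoint ha.1
      rw [IsSelfAdjoint, star_smul, star_one] at this
      exact this)
    obtain ⟨s, rfl⟩ := Complex.conj_eq_iff_real.1 ht
    have h0 : τ.D.L ((s : ℂ) • (1 : τ.D.carrier)) = 0 := τ.D.L.map_real s
    have h1 : τ.π ((s : ℂ) • (1 : τ.D.carrier)) = (s : ℂ) • (1 : A.carrier) := by
      rw [map_smul, map_one]
    have h2 : τ.ρ ((s : ℂ) • (1 : τ.D.carrier)) = (s : ℂ) • (1 : B.carrier) := by
      rw [map_smul, map_one]
    refine ⟨τ.ρ ((s : ℂ) • (1 : τ.D.carrier)), ⟨(s : ℂ) • (1 : τ.D.carrier),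
      ⟨⟨?_, τ.D.supportedOn_univ _⟩, h1, B.mem_locBall ?_ _, ?_⟩, rfl⟩, s, h2⟩
    · exact h0.trans_lt ENNReal.zero_lt_top
    · change B.L (τ.ρ ((s : ℂ) • (1 : τ.D.carrier))) < ∞
      rw [h2, B.L.map_real]
      exact ENNReal.zero_lt_top
    · exact h0.trans_le zero_le
  lip_le := fun d _ => τ.inv.le_left d

theorem baseDist_eq : τ.toPassage.baseDist = 0 := by
  refine nonpos_iff_eq_zero.1 (iSup₂_le fun m _ => ?_)
  obtain ⟨t, ht⟩ := m.2
  have h1 : A.toPointedProper.base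
      ⟨τ.toPassage.π m, τ.toPassage.topographic_π.map_mem m m.2⟩ = t :=
    scalarPart_eq (A := A.carrier) (by
      change τ.π m.1 = _
      rw [ht, map_smul, map_one])
  have h2 : B.toPointedProper.base
      ⟨τ.toPassage.ρ m, τ.toPassage.topographic_ρ.map_mem m m.2⟩ = t :=
    scalarPart_eq (A := B.carrier) (by
      change τ.ρ m.1 = _
      rw [ht, map_smul, map_one])
  dsimp only
  rw [h1, h2, edist_self]

end CompactTunnel

theorem localPropinquity_le_dualPropinquity (A B : LeibnizQCMS.{u}) (r : ℝ) :
    localPropinquity r A.toPointedProper B.toPointedProper ≤ dualPropinquity A B := by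
  refine le_iInf fun τ => le_of_forall_gt_imp_ge_of_dense fun c hc => ?_
  obtain ⟨ε, -, hε, hεc⟩ := ENNReal.lt_iff_exists_real_btwn.1 hc
  have hε0 : 0 < ε := ENNReal.ofReal_pos.1 (zero_le.trans_lt hε)
  have hmem : ε ∈ τ.toPassage.Adm r := by
    refine ⟨hε0, fun _ => Set.univ, fun t _ => ?_, fun _ _ _ _ _ => le_rfl, fun t _ => ?_⟩
    · exact Set.Subsingleton.isCompact fun x _ y _ =>
        (spec_scalars_eq (A := τ.D.carrier) x).trans
          (spec_scalars_eq (A := τ.D.carrier) y).symm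
    · exact ⟨τ.leftAdmissible hε, τ.inv.leftAdmissible (τ.extent_inv.trans_lt hε),
        τ.baseDist_eq.trans_le zero_le,
        fun a _ b _ => τ.D.leibniz a trivial b trivial⟩
  exact ((iInf₂_le τ.toPassage ⟨ε, hmem⟩).trans (iInf₂_le ε hmem)).trans hεc.le

/-! ### From passages to tunnels -/

theorem LeibnizOn.univ {D : Type u} [NonUnitalCStarAlgebra D] {L : LipSeminorm D} {S : Set D}
    (h : LeibnizOn L S) (hS : ∀ a, L a < ∞ → a ∈ S) : LeibnizOn L Set.univ := by
  intro a _ b _ ha hb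
  have h0 : L 0 = 0 := (L.eq_zero_iff 0).2 (Or.inl rfl)
  rcases eq_or_ne a 0 with rfl | ha0
  · simp [h0]
  rcases eq_or_ne b 0 with rfl | hb0
  · simp [h0]
  by_cases hLa : L a < ∞
  · by_cases hLb : L b < ∞
    · exact h a (hS a hLa) b (hS b hLb) ha hb
    · have : ‖a‖ₑ * L b = ∞ := by
        rw [not_lt_top_iff.1 hLb]
        exact ENNReal.mul_top (by simpa using ha0)
      simp [this]
  · have : L a * ‖b‖ₑ = ∞ := by
      rw [not_lt_top_iff.1 hLa]
      exact ENNReal.top_mul (by simpa using hb0)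
    simp [this]

/-- The algebra of an admissible passage from a quantum compact metric space is unital, and its
unit is local. -/
theorem Passage.LeftAdmissible.exists_unit {A : LeibnizQCMS.{u}} {X : PointedProperQMS.{u}}
    {τ : Passage A.toPointedProper X} {r ε : ℝ} {K : Set (Spec τ.M)}
    (h : τ.LeftAdmissible r ε K) : ∃ e : τ.carrier, (∀ b, e * b = b ∧ b * e = b) ∧
      SupportedOn τ.M K e ∧ τ.ρ e ∈ X.locBall (r + 4 * ε) ∧ τ.π e = (1 : A.carrier) := by
  have h1 : A.L (1 : A.carrier) = 0 := by simpa using A.L.map_real 1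
  obtain ⟨-, d, ⟨⟨-, hd⟩, hπ, hρ, hL⟩, rfl⟩ := h.target_nonempty (1 : A.carrier)
    (A.mem_locBall (h1.trans_lt ENNReal.zero_lt_top) r)
  have hL0 : τ.L d = 0 := nonpos_iff_eq_zero.1 (hL.trans h1.le)
  rcases (τ.L.eq_zero_iff d).1 hL0 with rfl | ⟨e, t, he, rfl⟩
  · exact absurd ((map_zero τ.π).symm.trans hπ).symm (one_ne_zero (α := A.carrier))
  · have h2 : τ.π e = (1 : A.carrier) := by
      have h3 := map_mul τ.π e ((t : ℂ) • e)
      rw [(he _).1, hπ] at h3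
      exact (h3.trans (mul_one (M := A.carrier) (τ.π e))).symm
    have h4 : (t : ℂ) = 1 := smul_one_inj (A := A.carrier) (by
      rw [one_smul]
      refine Eq.trans ?_ hπ
      rw [map_smul, h2]
      rfl)
    rw [h4, one_smul] at hd hρ
    exact ⟨e, he, hd, hρ, h2⟩

/-- A *-morphism of C*-algebras which maps `1` to `1`, as a unital morphism. -/
def unitalHom {D A : Type u} [CStarAlgebra D] [CStarAlgebra A] (π : D →⋆ₙₐ[ℂ] A) (h : π 1 = 1) :
    D →⋆ₐ[ℂ] A :=
  { π with
    map_one' := h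
    commutes' := fun c => by
      change π _ = _
      rw [Algebra.algebraMap_eq_smul_one, Algebra.algebraMap_eq_smul_one, map_smul, h] }

theorem map_one_of_surjective {D A : Type u} [CStarAlgebra D] [CStarAlgebra A]
    (π : D →⋆ₙₐ[ℂ] A) (h : Function.Surjective π) : π 1 = 1 := by
  obtain ⟨d, hd⟩ := h 1
  rw [← mul_one (π 1), ← hd, ← map_mul, one_mul]

theorem quotient_of_lift {D A : Type u} [CStarAlgebra D] [CStarAlgebra A] (L : LipSeminorm D)
    (LA : LipSeminorm A) (π : D →⋆ₙₐ[ℂ] A) (hle : ∀ d, L d < ∞ → LA (π d) ≤ L d)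
    (hlift : ∀ a, LA a < ∞ → ∃ d, π d = a ∧ L d ≤ LA a) (a : A) :
    LA a = ⨅ (d) (_ : IsSelfAdjoint d ∧ π d = a), L d := by
  refine le_antisymm (le_iInf₂ fun d hd => ?_) ?_
  · by_cases h : L d < ∞
    · exact hd.2 ▸ hle d h
    · rw [not_lt_top_iff.1 h]
      exact le_top
  · by_cases h : LA a < ∞
    · obtain ⟨d, hd, hL⟩ := hlift a h
      exact (iInf₂_le d ⟨L.isSelfAdjoint (hL.trans_lt h), hd⟩).trans hL
    · rw [not_lt_top_iff.1 h]
      exact le_top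

theorem dualPropinquity_le_of_admissiblePair {A B : LeibnizQCMS.{u}}
    (τ : Passage A.toPointedProper B.toPointedProper) {r ε : ℝ} {K : Set (Spec τ.M)}
    (hK : IsCompact K) (h : τ.AdmissiblePair r ε K) : dualPropinquity A B ≤ ENNReal.ofReal ε := by
  obtain ⟨e, he, heK, -, -⟩ := h.left.exists_unit
  obtain @⟨D, alg, L, M, hlc, hls, π, ρ, hπ, hρ⟩ := τ
  dsimp only at e he heK K hK
  obtain ⟨c, rfl⟩ := exists_cstarAlgebra alg e he
  have h1 : e = 1 := by rw [← mul_one e, (he 1).1]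
  subst h1
  have hM := hlc.topography
  have hsupp := supportedOn_of_one hM heK
  have hloc : ∀ a, L a < ∞ → a ∈ Loc L M K := fun a ha => ⟨ha, hsupp a⟩
  let πA : D →⋆ₙₐ[ℂ] A.carrier := π
  let ρB : D →⋆ₙₐ[ℂ] B.carrier := ρ
  have : Nontrivial D := hπ.surjective.nontrivial (α := D) (β := A.carrier)
  let Q : LeibnizQCMS :=
    { carrier := D
      L := L
      leibniz := h.leibniz.univ hloc
      lowerSemi := hls
      metrizes := metrizes_of_supportedOn_one hlc hK heK }
  let σ : CompactTunnel A B :=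
    { D := Q
      π := unitalHom πA (map_one_of_surjective πA hπ.surjective)
      ρ := unitalHom ρB (map_one_of_surjective ρB hρ.surjective)
      surjective_π := hπ.surjective
      surjective_ρ := hρ.surjective
      quotient_π := fun a _ => quotient_of_lift L A.L πA (fun d hd => h.right.lip_le d (hloc d hd))
        (fun a ha => by
          obtain ⟨-, d, ⟨-, hd, -, hL⟩, -⟩ := h.left.target_nonempty a (A.mem_locBall ha r)
          exact ⟨d, hd, hL⟩) a
      quotient_ρ := fun b _ => quotient_of_lift L B.L ρB (fun d hd => h.left.lip_le d (hloc d hd))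
        (fun b hb => by
          obtain ⟨-, d, ⟨-, hd, -, hL⟩, -⟩ := h.right.target_nonempty b (B.mem_locBall hb r)
          exact ⟨d, hd, hL⟩) b }
  have hstates := localStates_eq_univ hM heK
  refine (iInf_le _ σ).trans (max_le ?_ ?_)
  · refine @Metric.hausdorffEDist_le_of_mem_edist _ (mkMetric L) _ _ _ (fun φ _ => ?_)
      (fun φ _ => ⟨φ, trivial, ((mkMetric L).edist_self φ).trans_le zero_le⟩)
    obtain ⟨ψ, ⟨χ, -, hχ⟩, hψ⟩ := h.left.almost_subset φ (hstates.ge trivial)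
    exact ⟨ψ, ⟨χ, trivial, hχ⟩, hψ⟩
  · refine @Metric.hausdorffEDist_le_of_mem_edist _ (mkMetric L) _ _ _ (fun φ _ => ?_)
      (fun φ _ => ⟨φ, trivial, ((mkMetric L).edist_self φ).trans_le zero_le⟩)
    obtain ⟨ψ, ⟨χ, -, hχ⟩, hψ⟩ := h.right.almost_subset φ (hstates.ge trivial)
    exact ⟨ψ, ⟨χ, trivial, hχ⟩, hψ⟩

theorem exists_passage_of_localPropinquity_lt {X Y : PointedProperQMS.{u}} {r ε : ℝ} (hr : 0 < r)
    (h : localPropinquity r X Y < ENNReal.ofReal ε) : ∃ (τ : Passage X Y) (δ : ℝ)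
      (K : Set (Spec τ.M)), 0 < δ ∧ δ < ε ∧ IsCompact K ∧ τ.AdmissiblePair r δ K := by
  obtain ⟨τ, h1⟩ := iInf_lt_iff.1 h
  obtain ⟨-, h2⟩ := iInf_lt_iff.1 h1
  obtain ⟨δ, h3⟩ := iInf_lt_iff.1 h2
  obtain ⟨⟨hδ, K, hK, -, hadm⟩, h4⟩ := iInf_lt_iff.1 h3
  exact ⟨τ, δ, K r, hδ, (ENNReal.ofReal_lt_ofReal_iff_of_nonneg hδ.le).1 h4,
    hK r ⟨hr, le_rfl⟩, hadm r ⟨hr, le_rfl⟩⟩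

theorem dualPropinquity_le_localPropinquity (A B : LeibnizQCMS.{u}) {r : ℝ} (hr : 0 < r) :
    dualPropinquity A B ≤ localPropinquity r A.toPointedProper B.toPointedProper := by
  refine le_of_forall_gt_imp_ge_of_dense fun c hc => ?_
  obtain ⟨ε, -, hε, hεc⟩ := ENNReal.lt_iff_exists_real_btwn.1 hc
  obtain ⟨τ, δ, K, -, hδε, hK, h⟩ := exists_passage_of_localPropinquity_lt hr hε
  exact ((dualPropinquity_le_of_admissiblePair τ hK h).trans
    (ENNReal.ofReal_le_ofReal hδε.le)).trans hεc.le

/-! ### Limits of quantum compact metric spaces -/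

theorem exists_passage_of_tendsto {X : PointedProperQMS.{u}} {A : ℕ → LeibnizQCMS.{u}}
    (h : Tendsto (fun n => propinquity (A n).toPointedProper X) atTop (𝓝 0)) {η : ℝ} (hη : 0 < η) :
    ∃ (Y : LeibnizQCMS.{u}) (τ : Passage Y.toPointedProper X) (r δ : ℝ) (K : Set (Spec τ.M)),
      1 / η < r ∧ 0 < δ ∧ δ < η ∧ IsCompact K ∧ τ.AdmissiblePair r δ K := by
  have hpos : (0 : ℝ≥0∞) < min (ENNReal.ofReal η) (ENNReal.ofReal (√2 / 4)) :=
    lt_min (ENNReal.ofReal_pos.2 hη) (ENNReal.ofReal_pos.2 (by positivity))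
  obtain ⟨n, hn⟩ := (h.eventually (gt_mem_nhds hpos)).exists
  rcases min_lt_iff.1 hn with h1 | h1
  · obtain ⟨ε, h2⟩ := iInf_lt_iff.1 h1
    obtain ⟨⟨hε, hloc⟩, h3⟩ := iInf_lt_iff.1 h2
    have hεη : ε < η :=
      (ENNReal.ofReal_lt_ofReal_iff_of_nonneg hε.le).1 (h3.trans_le (min_le_left _ _))
    obtain ⟨τ, δ, K, hδ, hδε, hK, hadm⟩ :=
      exists_passage_of_localPropinquity_lt (one_div_pos.2 hε) hloc
    exact ⟨A n, τ, 1 / ε, δ, K, one_div_lt_one_div_of_lt hε hεη, hδ, hδε.trans hεη, hK, hadm⟩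
  · exact absurd (h1.trans_le (min_le_right _ _)) (lt_irrefl _)

/-- The elements of the topography of a unital space are almost constant if there is an admissible
passage from a quantum compact metric space. -/
theorem exists_norm_sub_le_of_admissiblePair {A : LeibnizQCMS.{u}} {C : Type u} [CStarAlgebra C]
    {L : LipSeminorm C} {M : NonUnitalStarSubalgebra ℂ C} {hX : IsProperQMS L M} {x : Spec M}
    (τ : Passage A.toPointedProper ⟨C, L, M, hX, x⟩) {r δ : ℝ} {K : Set (Spec τ.M)}
    (h : τ.AdmissiblePair r δ K) (hδ : 0 ≤ δ) (h1 : SupportedOn M (specBall L M x r) (1 : C))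
    {a : C} (ha : a ∈ M) {c : ℝ} (hc : 0 < c) (hac : L a ≤ ENNReal.ofReal c) :
    ∃ t : ℂ, ∀ φ : State C, ‖φ a - t‖ ≤ c * δ := by
  have hM := hX.locallyCompact.topography
  have haloc : a ∈ PointedProperQMS.locBall ⟨C, L, M, hX, x⟩ r :=
    ⟨hac.trans_lt ENNReal.ofReal_lt_top, supportedOn_of_one hM h1 a⟩
  obtain ⟨-, ⟨d, ⟨-, hρd, -, hL⟩, rfl⟩, t, ht⟩ := h.right.target_topography a haloc ha
  refine ⟨t, fun φ => ?_⟩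
  obtain ⟨e, he, heK, -, -⟩ := h.left.exists_unit
  have hstates := localStates_eq_univ hM h1
  obtain @⟨D, alg, LD, MD, hlc, hls, π, ρ, hπ, hρ⟩ := τ
  dsimp only at e he heK K d
  obtain ⟨cD, rfl⟩ := exists_cstarAlgebra alg e he
  have he1 : e = 1 := by rw [← mul_one e, (he 1).1]
  subst he1
  let ρC : D →⋆ₙₐ[ℂ] C := ρ
  have : Nontrivial D := hπ.surjective.nontrivial (α := D) (β := A.carrier)
  let φD : State D := State.comap φ (unitalHom ρC (map_one_of_surjective ρC hρ.surjective))
  obtain ⟨χ, ⟨ψ, -, hψ⟩, hmk⟩ := h.left.almost_subset φD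
    ((localStates_eq_univ hlc.topography heK).ge trivial)
  have h2 := norm_sub_le_of_mk LD hc hδ (hL.trans hac) hmk
  have h3 : φD d = φ a := congrArg (fun b : C => φ b) hρd
  have h4 : χ d = t := by
    refine (hψ d).trans ((congrArg (fun b : A.carrier => ψ.1 b) ht).trans ?_)
    exact State.map_real (A := A.carrier) ψ t
  rw [h3, h4] at h2
  exact h2

theorem exists_eq_toPointedProper {X : PointedProperQMS.{u}} {A : ℕ → LeibnizQCMS.{u}}
    (h : Tendsto (fun n => propinquity (A n).toPointedProper X) atTop (𝓝 0)) :
    ∃ Y : LeibnizQCMS.{u}, X = Y.toPointedProper := by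
  have H := fun (η : ℝ) (hη : 0 < η) => exists_passage_of_tendsto h hη
  clear h
  obtain ⟨Y, τ, r, δ, K, -, -, -, -, hadm⟩ := H 1 one_pos
  obtain ⟨e, he, -, heX, -⟩ := hadm.left.exists_unit
  have hu : ∀ b, τ.ρ e * b = b ∧ b * τ.ρ e = b := fun b => by
    obtain ⟨d, rfl⟩ := τ.topographic_ρ.surjective b
    rw [← map_mul, ← map_mul, (he d).1, (he d).2]
    exact ⟨rfl, rfl⟩
  generalize τ.ρ e = u at hu heX
  clear hadm he e
  generalize r + 4 * δ = R at heX
  clear K τ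
  obtain @⟨C, alg, L, M, hX, x⟩ := X
  dsimp only at u hu
  obtain ⟨c, rfl⟩ := exists_cstarAlgebra alg u hu
  have hu1 : u = 1 := by rw [← mul_one u, (hu 1).1]
  subst hu1
  have hM := hX.locallyCompact.topography
  have hsupp : SupportedOn M (specBall L M x R) (1 : C) := heX.2
  have hnt : Nontrivial C := by
    by_contra hn
    rw [not_nontrivial_iff_subsingleton] at hn
    have h1 := apply_one_spec hM.one_mem x
    rw [Subsingleton.elim (⟨1, hM.one_mem⟩ : M) 0, map_zero] at h1
    exact zero_ne_one h1
  have hconst : ∀ a ∈ M, L a < ∞ → a ∈ scalars C := by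
    intro a ha hLa
    have hc : 0 < (L a).toReal + 1 := by positivity
    have hac : L a ≤ ENNReal.ofReal ((L a).toReal + 1) :=
      ((ENNReal.lt_ofReal_iff_toReal_lt hLa.ne).2 (lt_add_one _)).le
    have hsa := L.isSelfAdjoint hLa
    let φ₀ : State C := Classical.arbitrary _
    have heq : ∀ φ : State C, φ a = φ₀ a := by
      intro φ
      rw [← sub_eq_zero, ← norm_le_zero_iff]
      refine le_of_forall_pos_le_add fun ε hε => ?_
      obtain ⟨Y, τ, r, δ, K, hr, hδ, hδη, -, hadm⟩ :=
        H (min (1 / (|R| + 1)) (ε / (2 * ((L a).toReal + 1)))) (lt_min (by positivity)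
          (by positivity))
      have hRr : R ≤ r := by
        have h1 : |R| + 1 ≤ 1 / min (1 / (|R| + 1)) (ε / (2 * ((L a).toReal + 1))) := by
          rw [le_one_div (by positivity) (lt_min (by positivity) (by positivity))]
          exact min_le_left _ _
        linarith [le_abs_self R]
      have hsub : specBall L M x R ⊆ specBall L M x r := fun y hy =>
        le_trans hy (ENNReal.ofReal_le_ofReal hRr)
      obtain ⟨t, ht⟩ :=
        exists_norm_sub_le_of_admissiblePair τ hadm hδ.le (hsupp.mono hsub) ha hc hac
      have h1 := ht φ
      have h2 := ht φ₀
      have h3 : ((L a).toReal + 1) * δ ≤ ε / 2 := by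
        have h4 := hδη.le.trans (min_le_right _ _)
        rw [le_div_iff₀ (by positivity)] at h4
        linarith
      rw [zero_add]
      calc ‖φ a - φ₀ a‖ = ‖(φ a - t) - (φ₀ a - t)‖ := by congr 1; ring
        _ ≤ ‖φ a - t‖ + ‖φ₀ a - t‖ := norm_sub_le _ _
        _ ≤ ε := by linarith
    refine ⟨((φ₀ a).re : ℂ), sub_eq_zero.1 (norm_le_zero_iff.1 ?_)⟩
    refine norm_le_of_states (hsa.sub (isSelfAdjoint_real _)) fun φ => ?_
    rw [φ.map_sub, φ.map_real, φ₀.ofReal_re hsa, heq, sub_self, norm_zero]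
  have hsaM : ∀ a ∈ M, IsSelfAdjoint a → a ∈ scalars C := fun a ha hsa =>
    (isTopography_scalars C).isClosed.closure_subset_iff.2
      (fun b hb => hconst b hb.2 (by obtain ⟨⟨K, -, hb, -⟩, -⟩ := hb; exact hb))
      (hX.dense_loc_topography ⟨ha, hsa⟩)
  obtain rfl : M = scalars C := by
    refine le_antisymm (fun a ha => ?_) ?_
    · have hre : (realPart a : C) ∈ M := by
        rw [realPart_apply_coe, ← Complex.coe_smul]
        exact SMulMemClass.smul_mem _ (add_mem ha (star_mem ha))
      have him : (imaginaryPart a : C) ∈ M := by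
        rw [imaginaryPart_apply_coe, ← Complex.coe_smul]
        exact SMulMemClass.smul_mem _ (SMulMemClass.smul_mem _ (sub_mem ha (star_mem ha)))
      rw [← realPart_add_I_smul_imaginaryPart a]
      exact add_mem (hsaM _ hre (realPart a).2)
        (SMulMemClass.smul_mem _ (hsaM _ him (imaginaryPart a).2))
    · rintro _ ⟨t, rfl⟩
      exact SMulMemClass.smul_mem t hM.one_mem
  obtain rfl := spec_scalars_eq x
  have hK : IsCompact (Set.univ : Set (Spec (scalars C))) :=
    Set.Subsingleton.isCompact fun y _ z _ => (spec_scalars_eq y).trans (spec_scalars_eq z).symm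
  exact ⟨{ carrier := C
           L := L
           leibniz := hX.leibniz
           lowerSemi := hX.lowerSemi
           metrizes := metrizes_of_supportedOn_one hX.locallyCompact hK
             (hsupp.mono (Set.subset_univ _)) }, rfl⟩

/-! ### Composition of tunnels -/

section Prod

variable {D₁ D₂ B : Type u} [CStarAlgebra D₁] [CStarAlgebra D₂] [CStarAlgebra B]

theorem norm_jordan_lie_sub_le (x x' y y' : B) {a b : ℝ} (hx : ‖x‖ ≤ a) (hx' : ‖x'‖ ≤ a)
    (hy : ‖y‖ ≤ b) (hy' : ‖y'‖ ≤ b) :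
    ‖(1 / 2 : ℂ) • (x * y + y * x) - (1 / 2 : ℂ) • (x' * y' + y' * x')‖ ≤
        a * ‖y - y'‖ + ‖x - x'‖ * b ∧
      ‖(1 / (2 * Complex.I) : ℂ) • (x * y - y * x) -
        (1 / (2 * Complex.I) : ℂ) • (x' * y' - y' * x')‖ ≤ a * ‖y - y'‖ + ‖x - x'‖ * b := by
  have h1 : ‖x * y - x' * y'‖ ≤ a * ‖y - y'‖ + ‖x - x'‖ * b := by
    rw [show x * y - x' * y' = x * (y - y') + (x - x') * y' by noncomm_ring]
    refine (norm_add_le _ _).trans (add_le_add ((norm_mul_le _ _).trans ?_)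
      ((norm_mul_le _ _).trans ?_)) <;> gcongr
  have h2 : ‖y * x - y' * x'‖ ≤ a * ‖y - y'‖ + ‖x - x'‖ * b := by
    rw [show y * x - y' * x' = (y - y') * x' + y * (x - x') by noncomm_ring]
    refine (norm_add_le _ _).trans (add_le_add ((norm_mul_le _ _).trans ?_)
      ((norm_mul_le _ _).trans ?_))
    · rw [mul_comm]; gcongr
    · rw [mul_comm]; gcongr
  constructor
  · rw [← smul_sub, norm_smul,
      show x * y + y * x - (x' * y' + y' * x') = (x * y - x' * y') + (y * x - y' * x') by abel]
    have h3 := norm_add_le (x * y - x' * y') (y * x - y' * x')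
    have h4 : ‖(1 / 2 : ℂ)‖ = 1 / 2 := by norm_num
    rw [h4]
    linarith
  · rw [← smul_sub, norm_smul,
      show x * y - y * x - (x' * y' - y' * x') = (x * y - x' * y') - (y * x - y' * x') by abel]
    have h3 := norm_sub_le (x * y - x' * y') (y * x - y' * x')
    have h4 : ‖(1 / (2 * Complex.I) : ℂ)‖ = 1 / 2 := by simp
    rw [h4]
    linarith

theorem norm_starAlgHom_le (π : D₁ →⋆ₐ[ℂ] B) (d : D₁) : ‖π d‖ ≤ ‖d‖ :=
  NonUnitalStarAlgHom.norm_apply_le π d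

theorem continuous_starAlgHom (π : D₁ →⋆ₐ[ℂ] B) : Continuous π :=
  AddMonoidHomClass.continuous_of_bound π 1 fun d => by
    rw [one_mul]
    exact norm_starAlgHom_le π d

theorem enorm_le_of_norm_le {x y z : B} {a b : ℝ} (ha : 0 ≤ a) (hb : 0 ≤ b)
    (h : ‖x‖ ≤ a * ‖y‖ + ‖z‖ * b) :
    ‖x‖ₑ ≤ ENNReal.ofReal a * ‖y‖ₑ + ‖z‖ₑ * ENNReal.ofReal b := by
  rw [← ofReal_norm, ← ofReal_norm, ← ofReal_norm, ← ENNReal.ofReal_mul ha,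
    ← ENNReal.ofReal_mul (norm_nonneg z), ← ENNReal.ofReal_add (by positivity) (by positivity)]
  exact ENNReal.ofReal_le_ofReal h

/-- The Lipschitz seminorm `max {L₁ d₁, L₂ d₂, ‖ρ d₁ - π d₂‖ / ε}` on the direct sum. -/
def prodLip [Nontrivial B] (L₁ : LipSeminorm D₁) (L₂ : LipSeminorm D₂) (ρ : D₁ →⋆ₐ[ℂ] B)
    (π : D₂ →⋆ₐ[ℂ] B) {ε : ℝ} (hε : 0 < ε) :
    @LipSeminorm (D₁ × D₂) (CStarAlgebra.toNonUnitalCStarAlgebra _) where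
  toFun d := max (max (L₁ d.1) (L₂ d.2)) (ENNReal.ofReal ε⁻¹ * ‖ρ d.1 - π d.2‖ₑ)
  eq_top d hd := by
    have h : ¬ IsSelfAdjoint d.1 ∨ ¬ IsSelfAdjoint d.2 := by
      by_contra h
      rw [not_or, not_not, not_not] at h
      exact hd (Prod.ext h.1 h.2)
    rcases h with h | h
    · simp [L₁.eq_top _ h]
    · simp [L₂.eq_top _ h]
  add_le a b := by
    refine max_le (max_le ?_ ?_) ?_
    · exact (L₁.add_le _ _).trans (add_le_add ((le_max_left _ _).trans (le_max_left _ _))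
        ((le_max_left _ _).trans (le_max_left _ _)))
    · exact (L₂.add_le _ _).trans (add_le_add ((le_max_right _ _).trans (le_max_left _ _))
        ((le_max_right _ _).trans (le_max_left _ _)))
    · refine le_trans ?_ (add_le_add (le_max_right _ _) (le_max_right _ _))
      rw [← mul_add]
      gcongr
      rw [Prod.fst_add, Prod.snd_add, map_add, map_add, add_sub_add_comm]
      exact enorm_add_le _ _
  smul_eq t a := by
    have h1 : ‖ρ ((t : ℂ) • a).1 - π ((t : ℂ) • a).2‖ₑ = ‖t‖ₑ * ‖ρ a.1 - π a.2‖ₑ := by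
      rw [Prod.smul_fst, Prod.smul_snd, map_smul, map_smul, ← smul_sub, enorm_smul]
      congr 1
      rw [← ofReal_norm, ← ofReal_norm, Complex.norm_real]
    rw [h1, Prod.smul_fst, Prod.smul_snd, L₁.smul_eq, L₂.smul_eq, mul_max, mul_max, mul_left_comm]
  dense_dom a ha := by
    have h1 : IsSelfAdjoint a.1 := congrArg Prod.fst ha
    have h2 : IsSelfAdjoint a.2 := congrArg Prod.snd ha
    have h3 : a ∈ closure ({b | L₁ b < ∞} ×ˢ {b | L₂ b < ∞}) := by
      rw [closure_prod_eq]
      exact ⟨L₁.dense_dom _ h1, L₂.dense_dom _ h2⟩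
    refine closure_mono (fun b hb => ?_) h3
    exact max_lt (max_lt hb.1 hb.2) (ENNReal.mul_lt_top ENNReal.ofReal_lt_top enorm_lt_top)
  eq_zero_iff a := by
    constructor
    · intro h
      have h1 : L₁ a.1 = 0 :=
        nonpos_iff_eq_zero.1 (h ▸ (le_max_left _ _).trans (le_max_left _ _))
      have h2 : L₂ a.2 = 0 :=
        nonpos_iff_eq_zero.1 (h ▸ (le_max_right _ _).trans (le_max_left _ _))
      have h3 : ENNReal.ofReal ε⁻¹ * ‖ρ a.1 - π a.2‖ₑ = 0 :=
        nonpos_iff_eq_zero.1 (h ▸ le_max_right _ _)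
      obtain ⟨s, hs⟩ := L₁.exists_of_eq_zero h1
      obtain ⟨t, ht⟩ := L₂.exists_of_eq_zero h2
      have h4 : ρ a.1 - π a.2 = 0 := by
        rcases mul_eq_zero.1 h3 with h | h
        · exact absurd h (ENNReal.ofReal_pos.2 (inv_pos.2 hε)).ne'
        · exact enorm_eq_zero.1 h
      rw [hs, ht, map_smul, map_smul, map_one, map_one, sub_eq_zero] at h4
      have h5 := smul_one_inj h4
      exact Or.inr ⟨1, s, fun b => ⟨one_mul b, mul_one b⟩,
        Prod.ext hs (by rw [ht, h5]; rfl)⟩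
    · intro h
      obtain ⟨t, rfl⟩ : ∃ t : ℝ, a = (t : ℂ) • (1 : D₁ × D₂) := by
        rcases h with rfl | ⟨e, t, he, rfl⟩
        · exact ⟨0, by simp⟩
        · exact ⟨t, by rw [← (he 1).1, mul_one]⟩
      rw [Prod.smul_fst, Prod.smul_snd, Prod.fst_one, Prod.snd_one, L₁.map_real, L₂.map_real,
        map_smul, map_smul, map_one, map_one, sub_self, enorm_zero, mul_zero, max_self, max_self]

variable [Nontrivial B] (L₁ : LipSeminorm D₁) (L₂ : LipSeminorm D₂) (ρ : D₁ →⋆ₐ[ℂ] B)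
  (π : D₂ →⋆ₐ[ℂ] B) {ε : ℝ} (hε : 0 < ε)

theorem prodLip_apply (d : D₁ × D₂) : prodLip L₁ L₂ ρ π hε d =
    max (max (L₁ d.1) (L₂ d.2)) (ENNReal.ofReal ε⁻¹ * ‖ρ d.1 - π d.2‖ₑ) := rfl

theorem prodLip_le_one_iff (d : D₁ × D₂) : prodLip L₁ L₂ ρ π hε d ≤ 1 ↔
    L₁ d.1 ≤ 1 ∧ L₂ d.2 ≤ 1 ∧ ‖ρ d.1 - π d.2‖ ≤ ε := by
  rw [prodLip_apply, max_le_iff, max_le_iff, and_assoc, ← ofReal_norm,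
    ← ENNReal.ofReal_mul (inv_nonneg.2 hε.le), ENNReal.ofReal_le_one, inv_mul_le_iff₀ hε, mul_one]

theorem leibnizOn_prodLip (h₁ : LeibnizOn L₁ Set.univ) (h₂ : LeibnizOn L₂ Set.univ) :
    LeibnizOn (prodLip L₁ L₂ ρ π hε) Set.univ := by
  intro a _ b _ ha hb
  obtain ⟨h11, h12⟩ := h₁ a.1 trivial b.1 trivial (congrArg Prod.fst ha) (congrArg Prod.fst hb)
  obtain ⟨h21, h22⟩ := h₂ a.2 trivial b.2 trivial (congrArg Prod.snd ha) (congrArg Prod.snd hb)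
  have n1 : ∀ d : D₁ × D₂, ‖d.1‖ₑ ≤ ‖d‖ₑ := fun d => by
    rw [← ofReal_norm, ← ofReal_norm]
    exact ENNReal.ofReal_le_ofReal (norm_fst_le d)
  have n2 : ∀ d : D₁ × D₂, ‖d.2‖ₑ ≤ ‖d‖ₑ := fun d => by
    rw [← ofReal_norm, ← ofReal_norm]
    exact ENNReal.ofReal_le_ofReal (norm_snd_le d)
  have l1 : ∀ d : D₁ × D₂, L₁ d.1 ≤ prodLip L₁ L₂ ρ π hε d := fun d =>
    (le_max_left _ _).trans (le_max_left _ _)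
  have l2 : ∀ d : D₁ × D₂, L₂ d.2 ≤ prodLip L₁ L₂ ρ π hε d := fun d =>
    (le_max_right _ _).trans (le_max_left _ _)
  have l3 : ∀ d : D₁ × D₂, ENNReal.ofReal ε⁻¹ * ‖ρ d.1 - π d.2‖ₑ ≤ prodLip L₁ L₂ ρ π hε d :=
    fun d => le_max_right _ _
  have key : ∀ d : D₁ × D₂,
      ‖ρ d.1 - π d.2‖ ≤ ‖a‖ * ‖ρ b.1 - π b.2‖ + ‖ρ a.1 - π a.2‖ * ‖b‖ →
      ENNReal.ofReal ε⁻¹ * ‖ρ d.1 - π d.2‖ₑ ≤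
        ‖a‖ₑ * prodLip L₁ L₂ ρ π hε b + prodLip L₁ L₂ ρ π hε a * ‖b‖ₑ := by
    intro d hd
    have h := enorm_le_of_norm_le (norm_nonneg a) (norm_nonneg b) hd
    rw [ofReal_norm, ofReal_norm] at h
    calc _ ≤ ENNReal.ofReal ε⁻¹ * (‖a‖ₑ * ‖ρ b.1 - π b.2‖ₑ + ‖ρ a.1 - π a.2‖ₑ * ‖b‖ₑ) := by gcongr
      _ = ‖a‖ₑ * (ENNReal.ofReal ε⁻¹ * ‖ρ b.1 - π b.2‖ₑ) +
          (ENNReal.ofReal ε⁻¹ * ‖ρ a.1 - π a.2‖ₑ) * ‖b‖ₑ := by ring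
      _ ≤ _ := add_le_add (mul_le_mul_right (l3 b) _) (mul_le_mul_left (l3 a) _)
  have hnorm := norm_jordan_lie_sub_le (ρ a.1) (π a.2) (ρ b.1) (π b.2)
    ((norm_starAlgHom_le ρ _).trans (norm_fst_le a))
    ((norm_starAlgHom_le π _).trans (norm_snd_le a))
    ((norm_starAlgHom_le ρ _).trans (norm_fst_le b))
    ((norm_starAlgHom_le π _).trans (norm_snd_le b))
  refine ⟨max_le (max_le (h11.trans ?_) (h21.trans ?_)) (key _ ?_),
    max_le (max_le (h12.trans ?_) (h22.trans ?_)) (key _ ?_)⟩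
  · exact add_le_add (mul_le_mul' (n1 a) (l1 b)) (mul_le_mul' (l1 a) (n1 b))
  · exact add_le_add (mul_le_mul' (n2 a) (l2 b)) (mul_le_mul' (l2 a) (n2 b))
  · simpa using hnorm.1
  · exact add_le_add (mul_le_mul' (n1 a) (l1 b)) (mul_le_mul' (l1 a) (n1 b))
  · exact add_le_add (mul_le_mul' (n2 a) (l2 b)) (mul_le_mul' (l2 a) (n2 b))
  · simpa using hnorm.2

theorem lowerSemi_prodLip (h₁ : LowerSemi L₁) (h₂ : LowerSemi L₂) :
    LowerSemi (prodLip L₁ L₂ ρ π hε) := by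
  refine lowerSemicontinuousOn_iff_preimage_Iic.2 fun c => ?_
  obtain ⟨v₁, hv₁, h1⟩ := (lowerSemicontinuousOn_iff_preimage_Iic.1 h₁) c
  obtain ⟨v₂, hv₂, h2⟩ := (lowerSemicontinuousOn_iff_preimage_Iic.1 h₂) c
  refine ⟨(Prod.fst ⁻¹' v₁ ∩ Prod.snd ⁻¹' v₂) ∩
    {d | ENNReal.ofReal ε⁻¹ * ‖ρ d.1 - π d.2‖ₑ ≤ c}, ?_, ?_⟩
  · refine ((hv₁.preimage continuous_fst).inter (hv₂.preimage continuous_snd)).inter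
      (isClosed_le ?_ continuous_const)
    have h3 : Continuous fun d : D₁ × D₂ => ‖ρ d.1 - π d.2‖ₑ :=
      (((continuous_starAlgHom ρ).comp continuous_fst).sub
        ((continuous_starAlgHom π).comp continuous_snd)).enorm
    exact (ENNReal.continuous_const_mul ENNReal.ofReal_ne_top).comp h3
  · ext d
    refine and_congr_right fun hd => ?_
    have hd1 : IsSelfAdjoint d.1 := congrArg Prod.fst hd
    have hd2 : IsSelfAdjoint d.2 := congrArg Prod.snd hd
    have e1 : L₁ d.1 ≤ c ↔ d.1 ∈ v₁ :=
      ⟨fun h => (h1.le ⟨hd1, h⟩).2, fun h => (h1.ge ⟨hd1, h⟩).2⟩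
    have e2 : L₂ d.2 ≤ c ↔ d.2 ∈ v₂ :=
      ⟨fun h => (h2.le ⟨hd2, h⟩).2, fun h => (h2.ge ⟨hd2, h⟩).2⟩
    change prodLip L₁ L₂ ρ π hε d ≤ c ↔ _
    rw [prodLip_apply, max_le_iff, max_le_iff, e1, e2]
    rfl

theorem metrizes_prodLip [Nontrivial D₁] [Nontrivial D₂]
    (hm₁ : mkTopology L₁ = (inferInstance : TopologicalSpace (State D₁))) (hl₁ : LowerSemi L₁)
    (hm₂ : mkTopology L₂ = (inferInstance : TopologicalSpace (State D₂))) (hl₂ : LowerSemi L₂) :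
    mkTopology (prodLip L₁ L₂ ρ π hε) = (inferInstance : TopologicalSpace (State (D₁ × D₂))) := by
  obtain ⟨C₁, hC₁, h₁⟩ := exists_norm_sub_le L₁ hm₁
  obtain ⟨C₂, hC₂, h₂⟩ := exists_norm_sub_le L₂ hm₂
  refine metrizes_of_totallyBounded _ (((isCompact_lip L₁ hm₁ hl₁ one_pos C₁).prod
    (isCompact_lip L₂ hm₂ hl₂ one_pos (C₂ + (C₁ + C₂ + ε)))).totallyBounded) fun a ha => ?_
  obtain ⟨ha1, ha2, ha3⟩ := (prodLip_le_one_iff L₁ L₂ ρ π hε a).1 ha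
  rw [← ENNReal.ofReal_one] at ha1 ha2
  obtain ⟨t, ht⟩ := h₁ a.1 1 one_pos ha1
  obtain ⟨s, hs⟩ := h₂ a.2 1 one_pos ha2
  rw [one_mul] at ht hs
  have hts : ‖((s : ℂ) - t)‖ ≤ C₁ + C₂ + ε := by
    have e1 := (norm_starAlgHom_le ρ _).trans ht
    have e2 := (norm_starAlgHom_le π _).trans hs
    rw [map_sub, map_smul, map_one] at e1 e2
    have e3 : ((s : ℂ) - t) • (1 : B) =
        (ρ a.1 - (t : ℂ) • (1 : B)) - (π a.2 - (s : ℂ) • (1 : B)) - (ρ a.1 - π a.2) := by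
      rw [sub_smul]
      abel
    have e4 : ‖((s : ℂ) - t) • (1 : B)‖ = ‖((s : ℂ) - t)‖ := by
      rw [norm_smul, CStarRing.norm_one, mul_one]
    rw [← e4, e3]
    refine (norm_sub_le _ _).trans (add_le_add ((norm_sub_le _ _).trans (add_le_add e1 e2)) ha3)
  refine ⟨t, ⟨(L₁.sub_real_le a.1 t).trans ha1, ht⟩, (L₂.sub_real_le a.2 t).trans ha2, ?_⟩
  change ‖a.2 - (t : ℂ) • (1 : D₂)‖ ≤ _
  have e5 : a.2 - (t : ℂ) • (1 : D₂) =
      (a.2 - (s : ℂ) • (1 : D₂)) + ((s : ℂ) - t) • (1 : D₂) := by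
    rw [sub_smul]
    abel
  rw [e5]
  refine (norm_add_le _ _).trans (add_le_add hs ?_)
  rw [norm_smul, CStarRing.norm_one, mul_one]
  exact hts

end Prod

/-- A state of a direct sum is a convex combination of states of the summands. -/
theorem State.exists_prod {D₁ D₂ : Type u} [CStarAlgebra D₁] [CStarAlgebra D₂] [Nontrivial D₁]
    [Nontrivial D₂] (φ : State (D₁ × D₂)) :
    ∃ (t : ℝ) (φ₁ : State D₁) (φ₂ : State D₂), 0 ≤ t ∧ t ≤ 1 ∧
      ∀ d : D₁ × D₂, φ d = t * φ₁ d.1 + (1 - t) * φ₂ d.2 := by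
  let f : (D₁ × D₂) →ₗ[ℂ] ℂ := (WeakDual.toStrongDual φ.1 : StrongDual ℂ (D₁ × D₂))
  let f₁ : D₁ →ₗ[ℂ] ℂ := f.comp (LinearMap.inl ℂ D₁ D₂)
  let f₂ : D₂ →ₗ[ℂ] ℂ := f.comp (LinearMap.inr ℂ D₁ D₂)
  have hf₁ : ∀ a, 0 ≤ f₁ (star a * a) := fun a => by
    have h := φ.2.1 (a, 0)
    have e : star ((a, 0) : D₁ × D₂) * (a, 0) = (star a * a, 0) := Prod.ext rfl (by simp)
    rw [e] at h
    exact h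
  have hf₂ : ∀ a, 0 ≤ f₂ (star a * a) := fun a => by
    have h := φ.2.1 (0, a)
    have e : star ((0, a) : D₁ × D₂) * (0, a) = (0, star a * a) := Prod.ext (by simp) rfl
    rw [e] at h
    exact h
  have hsum : ∀ d : D₁ × D₂, φ d = f₁ d.1 + f₂ d.2 := fun d => by
    change f d = f (d.1, 0) + f (0, d.2)
    rw [← _root_.map_add]
    simp
  obtain ⟨φ₁, h₁⟩ := exists_state_smul f₁ hf₁
  obtain ⟨φ₂, h₂⟩ := exists_state_smul f₂ hf₂
  have p₁ : 0 ≤ (f₁ 1).re := by simpa using (Complex.nonneg_iff.1 (hf₁ 1)).1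
  have p₂ : 0 ≤ (f₂ 1).re := by simpa using (Complex.nonneg_iff.1 (hf₂ 1)).1
  have h1 : (f₁ 1).re + (f₂ 1).re = 1 := by
    have h := (hsum 1).symm.trans φ.apply_one
    exact congrArg Complex.re h
  refine ⟨(f₁ 1).re, φ₁, φ₂, p₁, by linarith, fun d => ?_⟩
  rw [hsum, h₁, h₂ d.2]
  have h2 : (1 - ((f₁ 1).re : ℂ)) = ((f₂ 1).re : ℂ) := by
    rw [← Complex.ofReal_one, ← Complex.ofReal_sub]
    congr 1
    linarith
  rw [h2]

theorem State.exists_near_prod {D₁ D₂ E : Type u} [CStarAlgebra D₁] [CStarAlgebra D₂]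
    [CStarAlgebra E] [Nontrivial D₁] [Nontrivial D₂] [Nontrivial E]
    (L : @LipSeminorm (D₁ × D₂) (CStarAlgebra.toNonUnitalCStarAlgebra _))
    (f : D₁ × D₂ →⋆ₐ[ℂ] E) {δ : ℝ}
    (h₁ : ∀ φ : State D₁, ∃ ψ : State E, ∀ d : D₁ × D₂, L d ≤ 1 → ‖φ d.1 - ψ (f d)‖ ≤ δ)
    (h₂ : ∀ φ : State D₂, ∃ ψ : State E, ∀ d : D₁ × D₂, L d ≤ 1 → ‖φ d.2 - ψ (f d)‖ ≤ δ)
    (φ : State (D₁ × D₂)) :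
    ∃ ψ : State E, (mkMetric L).edist φ (ψ.comap f) ≤ ENNReal.ofReal δ := by
  obtain ⟨t, φ₁, φ₂, h0, h1, hφ⟩ := φ.exists_prod
  obtain ⟨ψ₁, hψ₁⟩ := h₁ φ₁
  obtain ⟨ψ₂, hψ₂⟩ := h₂ φ₂
  obtain ⟨ψ, hψ⟩ := exists_state_convex ψ₁ ψ₂ h0 h1
  refine ⟨ψ, mk_le L fun d hd => ?_⟩
  rw [State.comap_apply, hφ, hψ]
  have e1 := hψ₁ d hd
  have e2 := hψ₂ d hd
  calc ‖(t : ℂ) * φ₁ d.1 + (1 - t) * φ₂ d.2 - (t * ψ₁ (f d) + (1 - t) * ψ₂ (f d))‖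
      = ‖(t : ℂ) * (φ₁ d.1 - ψ₁ (f d)) + ((1 - t : ℝ) : ℂ) * (φ₂ d.2 - ψ₂ (f d))‖ := by
        congr 1
        push_cast
        ring
    _ ≤ t * δ + (1 - t) * δ := by
        refine (norm_add_le _ _).trans (add_le_add ?_ ?_)
        · rw [norm_mul, Complex.norm_real, Real.norm_of_nonneg h0]
          gcongr
        · rw [norm_mul, Complex.norm_real, Real.norm_of_nonneg (sub_nonneg.2 h1)]
          exact mul_le_mul_of_nonneg_left e2 (sub_nonneg.2 h1)
    _ = δ := by ring

namespace CompactTunnel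

variable {A B C : LeibnizQCMS.{u}}

/-- The composition of two tunnels. -/
def prod (τ : CompactTunnel A B) (σ : CompactTunnel B C) {ε : ℝ} (hε : 0 < ε) :
    CompactTunnel A C where
  D :=
    { carrier := τ.D.carrier × σ.D.carrier
      L := prodLip τ.D.L σ.D.L τ.ρ σ.π hε
      leibniz := leibnizOn_prodLip _ _ _ _ hε τ.D.leibniz σ.D.leibniz
      lowerSemi := lowerSemi_prodLip _ _ _ _ hε τ.D.lowerSemi σ.D.lowerSemi
      metrizes := metrizes_prodLip _ _ _ _ hε τ.D.metrizes τ.D.lowerSemi σ.D.metrizes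
        σ.D.lowerSemi }
  π := τ.π.comp (StarAlgHom.fst ℂ _ _)
  ρ := σ.ρ.comp (StarAlgHom.snd ℂ _ _)
  surjective_π := τ.surjective_π.comp Prod.fst_surjective
  surjective_ρ := σ.surjective_ρ.comp Prod.snd_surjective
  quotient_π a _ := by
    refine quotient_of_lift (prodLip τ.D.L σ.D.L τ.ρ σ.π hε) A.L
      ((τ.π.comp (StarAlgHom.fst ℂ _ _) : τ.D.carrier × σ.D.carrier →⋆ₐ[ℂ] A.carrier) :
        τ.D.carrier × σ.D.carrier →⋆ₙₐ[ℂ] A.carrier)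
      (fun d _ => (τ.le_left d.1).trans ((le_max_left _ _).trans (le_max_left _ _)))
      (fun a ha => ?_) a
    obtain ⟨d, hd, hL⟩ := τ.exists_lift ha
    have hb := τ.inv.le_left d
    obtain ⟨d', hd', hL'⟩ := σ.exists_lift (hb.trans_lt (hL.trans_lt ha))
    refine ⟨(d, d'), hd, max_le (max_le hL ((hL'.trans hb).trans hL)) ?_⟩
    change ENNReal.ofReal ε⁻¹ * ‖τ.ρ d - σ.π d'‖ₑ ≤ _
    rw [hd']
    change ENNReal.ofReal ε⁻¹ * ‖τ.ρ d - τ.ρ d‖ₑ ≤ _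
    rw [sub_self, enorm_zero, mul_zero]
    exact zero_le
  quotient_ρ c _ := by
    refine quotient_of_lift (prodLip τ.D.L σ.D.L τ.ρ σ.π hε) C.L
      ((σ.ρ.comp (StarAlgHom.snd ℂ _ _) : τ.D.carrier × σ.D.carrier →⋆ₐ[ℂ] C.carrier) :
        τ.D.carrier × σ.D.carrier →⋆ₙₐ[ℂ] C.carrier)
      (fun d _ => (σ.inv.le_left d.2).trans ((le_max_right _ _).trans (le_max_left _ _)))
      (fun c hc => ?_) c
    obtain ⟨d', hd', hL'⟩ := σ.inv.exists_lift hc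
    have hb := σ.le_left d'
    obtain ⟨d, hd, hL⟩ := τ.inv.exists_lift (hb.trans_lt (hL'.trans_lt hc))
    refine ⟨(d, d'), hd', max_le (max_le ((hL.trans hb).trans hL') hL') ?_⟩
    change ENNReal.ofReal ε⁻¹ * ‖τ.ρ d - σ.π d'‖ₑ ≤ _
    change τ.ρ d = σ.π d' at hd
    rw [hd, sub_self, enorm_zero, mul_zero]
    exact zero_le

theorem norm_sub_le_of_near {D : LeibnizQCMS.{u}} {φ ψ : State D.carrier} {δ : ℝ} (hδ : 0 ≤ δ)
    (h : (mkMetric D.L).edist φ ψ ≤ ENNReal.ofReal δ) {d : D.carrier} (hd : D.L d ≤ 1) :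
    ‖φ d - ψ d‖ ≤ δ := by
  have := norm_sub_le_of_mk D.L one_pos hδ (by simpa using hd) h
  rwa [one_mul] at this

theorem extent_le_of_near (τ : CompactTunnel A B) {δ : ℝ}
    (h₁ : ∀ φ : State τ.D.carrier, ∃ ψ : State A.carrier,
      (mkMetric τ.D.L).edist φ (ψ.comap τ.π) ≤ ENNReal.ofReal δ)
    (h₂ : ∀ φ : State τ.D.carrier, ∃ ψ : State B.carrier,
      (mkMetric τ.D.L).edist φ (ψ.comap τ.ρ) ≤ ENNReal.ofReal δ) :
    τ.extent ≤ ENNReal.ofReal δ := by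
  refine max_le ?_ ?_
  · refine @Metric.hausdorffEDist_le_of_mem_edist _ (mkMetric τ.D.L) _ _ _ (fun φ _ => ?_)
      (fun φ _ => ⟨φ, trivial, ((mkMetric τ.D.L).edist_self φ).trans_le zero_le⟩)
    obtain ⟨ψ, hψ⟩ := h₁ φ
    exact ⟨ψ.comap τ.π, ⟨ψ, trivial, fun _ => rfl⟩, hψ⟩
  · refine @Metric.hausdorffEDist_le_of_mem_edist _ (mkMetric τ.D.L) _ _ _ (fun φ _ => ?_)
      (fun φ _ => ⟨φ, trivial, ((mkMetric τ.D.L).edist_self φ).trans_le zero_le⟩)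
    obtain ⟨ψ, hψ⟩ := h₂ φ
    exact ⟨ψ.comap τ.ρ, ⟨ψ, trivial, fun _ => rfl⟩, hψ⟩

theorem extent_prod_le (τ : CompactTunnel A B) (σ : CompactTunnel B C) {ε e₁ e₂ : ℝ} (hε : 0 < ε)
    (h₁ : τ.extent < ENNReal.ofReal e₁) (h₂ : σ.extent < ENNReal.ofReal e₂) :
    (τ.prod σ hε).extent ≤ ENNReal.ofReal (e₁ + e₂ + ε) := by
  have p₁ : 0 < e₁ := ENNReal.ofReal_pos.1 (zero_le.trans_lt h₁)
  have p₂ : 0 < e₂ := ENNReal.ofReal_pos.1 (zero_le.trans_lt h₂)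
  have hbr : ∀ (χ : State B.carrier) (d : τ.D.carrier × σ.D.carrier),
      ‖τ.ρ d.1 - σ.π d.2‖ ≤ ε → ‖χ (τ.ρ d.1) - χ (σ.π d.2)‖ ≤ ε := fun χ d hd => by
    rw [← χ.map_sub]
    exact (χ.norm_apply_le _).trans hd
  refine extent_le_of_near _ (State.exists_near_prod _ _ (fun φ => ?_) (fun φ => ?_))
    (State.exists_near_prod _ _ (fun φ => ?_) (fun φ => ?_))
  · obtain ⟨ψ, hψ⟩ := τ.exists_near h₁ φ
    refine ⟨ψ, fun d hd => ?_⟩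
    obtain ⟨hd1, hd2, hd3⟩ := (prodLip_le_one_iff _ _ _ _ hε d).1 hd
    have e1 := norm_sub_le_of_near p₁.le hψ hd1
    change ‖φ d.1 - ψ (τ.π d.1)‖ ≤ e₁ at e1
    change ‖φ d.1 - ψ (τ.π d.1)‖ ≤ _
    linarith
  · obtain ⟨χ, hχ⟩ := σ.exists_near h₂ φ
    obtain ⟨ψ, hψ⟩ := τ.exists_near h₁ (χ.comap τ.ρ)
    refine ⟨ψ, fun d hd => ?_⟩
    obtain ⟨hd1, hd2, hd3⟩ := (prodLip_le_one_iff _ _ _ _ hε d).1 hd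
    have e1 := norm_sub_le_of_near p₁.le hψ hd1
    have e2 := norm_sub_le_of_near p₂.le hχ hd2
    have e3 := hbr χ d hd3
    rw [norm_sub_rev] at e3
    change ‖χ (τ.ρ d.1) - ψ (τ.π d.1)‖ ≤ e₁ at e1
    change ‖φ d.2 - χ (σ.π d.2)‖ ≤ e₂ at e2
    change ‖φ d.2 - ψ (τ.π d.1)‖ ≤ _
    have e4 := norm_sub_le_norm_sub_add_norm_sub (φ d.2) (χ (σ.π d.2)) (ψ (τ.π d.1))
    have e5 := norm_sub_le_norm_sub_add_norm_sub (χ (σ.π d.2)) (χ (τ.ρ d.1)) (ψ (τ.π d.1))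
    linarith
  · obtain ⟨χ, hχ⟩ := τ.inv.exists_near (τ.extent_inv.trans_lt h₁) φ
    obtain ⟨ψ, hψ⟩ := σ.inv.exists_near (σ.extent_inv.trans_lt h₂) (χ.comap σ.π)
    refine ⟨ψ, fun d hd => ?_⟩
    obtain ⟨hd1, hd2, hd3⟩ := (prodLip_le_one_iff _ _ _ _ hε d).1 hd
    have e1 := norm_sub_le_of_near p₂.le hψ hd2
    have e2 := norm_sub_le_of_near p₁.le hχ hd1
    have e3 := hbr χ d hd3
    change ‖χ (σ.π d.2) - ψ (σ.ρ d.2)‖ ≤ e₂ at e1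
    change ‖φ d.1 - χ (τ.ρ d.1)‖ ≤ e₁ at e2
    change ‖φ d.1 - ψ (σ.ρ d.2)‖ ≤ _
    have e4 := norm_sub_le_norm_sub_add_norm_sub (φ d.1) (χ (τ.ρ d.1)) (ψ (σ.ρ d.2))
    have e5 := norm_sub_le_norm_sub_add_norm_sub (χ (τ.ρ d.1)) (χ (σ.π d.2)) (ψ (σ.ρ d.2))
    linarith
  · obtain ⟨ψ, hψ⟩ := σ.inv.exists_near (σ.extent_inv.trans_lt h₂) φ
    refine ⟨ψ, fun d hd => ?_⟩
    obtain ⟨hd1, hd2, hd3⟩ := (prodLip_le_one_iff _ _ _ _ hε d).1 hd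
    have e1 := norm_sub_le_of_near p₂.le hψ hd2
    change ‖φ d.2 - ψ (σ.ρ d.2)‖ ≤ e₂ at e1
    change ‖φ d.2 - ψ (σ.ρ d.2)‖ ≤ _
    linarith

/-- The identity tunnel. -/
def refl (A : LeibnizQCMS.{u}) : CompactTunnel A A where
  D := A
  π := StarAlgHom.id ℂ _
  ρ := StarAlgHom.id ℂ _
  surjective_π := Function.surjective_id
  surjective_ρ := Function.surjective_id
  quotient_π a _ := quotient_of_lift A.L A.L (NonUnitalStarAlgHom.id ℂ A.carrier)
    (fun _ _ => le_rfl) (fun a _ => ⟨a, rfl, le_rfl⟩) a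
  quotient_ρ a _ := quotient_of_lift A.L A.L (NonUnitalStarAlgHom.id ℂ A.carrier)
    (fun _ _ => le_rfl) (fun a _ => ⟨a, rfl, le_rfl⟩) a

theorem extent_refl (A : LeibnizQCMS.{u}) : (refl A).extent = 0 := by
  have h : ∀ φ : State A.carrier, ∃ ψ : State A.carrier,
      (mkMetric A.L).edist φ (ψ.comap (StarAlgHom.id ℂ A.carrier)) ≤ ENNReal.ofReal 0 := fun φ =>
    ⟨φ, by
      rw [show φ.comap (StarAlgHom.id ℂ A.carrier) = φ from rfl, (mkMetric A.L).edist_self]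
      exact zero_le⟩
  exact nonpos_iff_eq_zero.1 ((extent_le_of_near (refl A) h h).trans ENNReal.ofReal_zero.le)

end CompactTunnel

theorem dualPropinquity_self (A : LeibnizQCMS.{u}) : dualPropinquity A A = 0 :=
  nonpos_iff_eq_zero.1 ((iInf_le _ (CompactTunnel.refl A)).trans (CompactTunnel.extent_refl A).le)

theorem dualPropinquity_le_of_lt {A B C : LeibnizQCMS.{u}} {ε e₁ e₂ : ℝ} (hε : 0 < ε)
    (h₁ : dualPropinquity A B < ENNReal.ofReal e₁) (h₂ : dualPropinquity B C < ENNReal.ofReal e₂) :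
    dualPropinquity A C ≤ ENNReal.ofReal (e₁ + e₂ + ε) := by
  obtain ⟨τ, hτ⟩ := iInf_lt_iff.1 h₁
  obtain ⟨σ, hσ⟩ := iInf_lt_iff.1 h₂
  exact (iInf_le _ (τ.prod σ hε)).trans (τ.extent_prod_le σ hε hτ hσ)

/-! ### Convergence for the hypertopology -/

theorem isClosed_iff_seqLimits {S : Set PointedProperQMS.{u}} : IsClosed S ↔ seqLimits S ⊆ S := by
  rw [← isOpen_compl_iff]
  change Sᶜᶜ ∈ {S | seqLimits S ⊆ S} ↔ _
  rw [compl_compl]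
  rfl

theorem tendsto_of_tendsto_propinquity {X : ℕ → PointedProperQMS.{u}} {Y : PointedProperQMS.{u}}
    (h : Tendsto (fun n => propinquity (X n) Y) atTop (𝓝 0)) : Tendsto X atTop (𝓝 Y) := by
  refine tendsto_nhds.2 fun U hU hY => ?_
  by_contra hn
  obtain ⟨k, hk, hkU⟩ := extraction_of_frequently_atTop (P := fun n => X n ∈ Uᶜ)
    (not_eventually.1 hn)
  exact isClosed_iff_seqLimits.1 hU.isClosed_compl
    ⟨X ∘ k, hkU, h.comp hk.tendsto_atTop⟩ hY

theorem propinquity_le_of_dualPropinquity_lt {A B : LeibnizQCMS.{u}} {ε : ℝ} (hε : 0 < ε)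
    (h : dualPropinquity A B < ENNReal.ofReal ε) :
    propinquity A.toPointedProper B.toPointedProper ≤ ENNReal.ofReal ε :=
  (min_le_left _ _).trans
    (iInf₂_le ε ⟨hε, (localPropinquity_le_dualPropinquity A B _).trans_lt h⟩)

theorem dualPropinquity_lt_of_propinquity_lt {A B : LeibnizQCMS.{u}} {ε : ℝ}
    (h : propinquity A.toPointedProper B.toPointedProper <
      min (ENNReal.ofReal ε) (ENNReal.ofReal (√2 / 4))) :
    dualPropinquity A B < ENNReal.ofReal ε := by
  rcases min_lt_iff.1 h with h1 | h1
  · obtain ⟨δ, h2⟩ := iInf_lt_iff.1 h1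
    obtain ⟨⟨hδ, hloc⟩, h3⟩ := iInf_lt_iff.1 h2
    exact ((dualPropinquity_le_localPropinquity A B (one_div_pos.2 hδ)).trans_lt hloc).trans
      (h3.trans_le (min_le_left _ _))
  · exact absurd (h1.trans_le (min_le_right _ _)) (lt_irrefl _)

theorem tendsto_propinquity_iff {A : ℕ → LeibnizQCMS.{u}} {B : LeibnizQCMS.{u}} :
    Tendsto (fun n => propinquity (A n).toPointedProper B.toPointedProper) atTop (𝓝 0) ↔
      Tendsto (fun n => dualPropinquity (A n) B) atTop (𝓝 0) := by
  constructor
  · intro h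
    refine ENNReal.tendsto_nhds_zero.2 fun c hc => ?_
    obtain ⟨ε, -, hε, hεc⟩ := ENNReal.lt_iff_exists_real_btwn.1 hc
    have hpos : (0 : ℝ≥0∞) < min (ENNReal.ofReal ε) (ENNReal.ofReal (√2 / 4)) :=
      lt_min hε (ENNReal.ofReal_pos.2 (by positivity))
    filter_upwards [h.eventually (gt_mem_nhds hpos)] with n hn
    exact (dualPropinquity_lt_of_propinquity_lt hn).le.trans hεc.le
  · intro h
    refine ENNReal.tendsto_nhds_zero.2 fun c hc => ?_
    obtain ⟨ε, -, hε, hεc⟩ := ENNReal.lt_iff_exists_real_btwn.1 hc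
    filter_upwards [h.eventually (gt_mem_nhds hε)] with n hn
    exact (propinquity_le_of_dualPropinquity_lt (ENNReal.ofReal_pos.1 hε) hn).trans hεc.le

/-- The class of the quantum compact metric spaces at distance at least `c` from `B` is closed. -/
theorem isClosed_image_le_dualPropinquity (B : LeibnizQCMS.{u}) (c : ℝ≥0∞) :
    IsClosed (LeibnizQCMS.toPointedProper '' {Y | c ≤ dualPropinquity Y B}) := by
  refine isClosed_iff_seqLimits.2 ?_
  rintro X ⟨Z, hZ, hlim⟩
  choose Y hY hYZ using hZ
  obtain rfl : (fun n => (Y n).toPointedProper) = Z := funext hYZ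
  obtain ⟨X', rfl⟩ := exists_eq_toPointedProper hlim
  refine ⟨X', ?_, rfl⟩
  by_contra hlt
  change ¬ c ≤ dualPropinquity X' B at hlt
  obtain ⟨e₂, he₂, h₂, h₂c⟩ := ENNReal.lt_iff_exists_real_btwn.1 (not_le.1 hlt)
  obtain ⟨e₃, -, h₃, h₃c⟩ := ENNReal.lt_iff_exists_real_btwn.1 h₂c
  have h23 : e₂ < e₃ := (ENNReal.ofReal_lt_ofReal_iff_of_nonneg he₂).1 h₃
  have hε : 0 < (e₃ - e₂) / 2 := by linarith
  obtain ⟨n, hn⟩ := ((tendsto_propinquity_iff.1 hlim).eventually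
    (gt_mem_nhds (ENNReal.ofReal_pos.2 hε))).exists
  have h := dualPropinquity_le_of_lt hε hn h₂
  rw [show (e₃ - e₂) / 2 + e₂ + (e₃ - e₂) / 2 = e₃ by ring] at h
  exact absurd ((hY n).trans h) (not_le.2 h₃c)

theorem toPointedProper_notMem (B : LeibnizQCMS.{u}) {c : ℝ≥0∞} (hc : 0 < c) :
    B.toPointedProper ∉ LeibnizQCMS.toPointedProper '' {Y | c ≤ dualPropinquity Y B} := by
  rintro ⟨Y, hY, h⟩
  have h1 := dualPropinquity_le_localPropinquity Y B one_pos
  rw [h] at h1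
  have h2 := localPropinquity_le_dualPropinquity B B 1
  rw [dualPropinquity_self] at h2
  exact absurd (hc.trans_le (hY.trans (h1.trans h2))) (lt_irrefl _)

theorem tendsto_dualPropinquity_of_tendsto {A : ℕ → LeibnizQCMS.{u}} {B : LeibnizQCMS.{u}}
    (h : Tendsto (fun n => (A n).toPointedProper) atTop (𝓝 B.toPointedProper)) :
    Tendsto (fun n => dualPropinquity (A n) B) atTop (𝓝 0) := by
  refine ENNReal.tendsto_nhds_zero.2 fun c hc => ?_
  have h1 := h.eventually ((isClosed_image_le_dualPropinquity B c).isOpen_compl.mem_nhds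
    (toPointedProper_notMem B hc))
  filter_upwards [h1] with n hn
  by_contra hle
  exact hn ⟨A n, (not_le.1 hle).le, rfl⟩

end QuantumMetric

end

theorem mainTheorem6 (A : ℕ → QuantumMetric.LeibnizQCMS.{u}) (B : QuantumMetric.LeibnizQCMS.{u}) :
    Tendsto (fun n => QuantumMetric.dualPropinquity (A n) B) atTop (𝓝 0) ↔
      Tendsto (fun n => (A n).toPointedProper) atTop (𝓝 B.toPointedProper) :=
  ⟨fun h => QuantumMetric.tendsto_of_tendsto_propinquity
    (QuantumMetric.tendsto_propinquity_iff.2 h), QuantumMetric.tendsto_dualPropinquity_of_tendsto⟩
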